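/- **Theorem (posterior contraction rate for $\boldsymbol\theta$).** For each sample size $T$ consider the Gaussian regression $y\mid\boldsymbol\theta,\sigma^2\sim\mathcal N_T(\mathbf Z\boldsymbol\theta,\sigma^2\mathbf I_T)$ with given $T\times\widetilde g$ design $\mathbf Z$, whose columns are partitioned into $G$ nonempty groups of sizes $g_1,\dots,g_G$, $\widetilde g=\sum_j g_j$, with column blocks $\mathbf Z_1,\dots,\mathbf Z_G$ and corresponding sub-vectors $\boldsymbol\theta_1,\dots,\boldsymbol\theta_G$ of $\boldsymbol\theta\in\mathbb R^{\widetilde g}$. The prior is $$\boldsymbol\theta_j\mid\sigma^2,\pi_0\ \overset{ind}{\sim}\ (1-\pi_0)\,\text{M-Laplace}(\mathbf 0,\sigma/\lambda_j)+\pi_0\,\delta_{\mathbf 0},\qquad \sigma^2\sim\text{Inv-Gamma}(a_1,b_1),\qquad \pi_0\sim\text{Beta}(c,d),$$ with $\sigma^2$ and $\pi_0$ independent, where $\text{M-Laplace}(\mathbf 0,\sigma/\lambda_j)$ has density on $\mathbb R^{g_j}$ proportional to $\exp(-\lambda_j\|\boldsymbol\theta_j\|_2/\sigma)$, and $a_1>1$,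 $b_1>0$ are fixed; $\Pi(\cdot\mid y,\mathbf Z)$ is the posterior. The quantities $\mathbf Z,G,g_j,\lambda_j>0,c>0,d>0$ and an integer $s_0$ may depend on $T$. Let $s_{\boldsymbol\theta}$ be the number of groups with $\boldsymbol\theta_j\ne\mathbf 0$, $\|\mathbf Z\|_o=\max_j\|\mathbf Z_j\|_{op}$ (spectral norms), $\epsilon=\max\{\sqrt{s_0\log(G)/T},\sqrt{\log(T)/T}\}$, $\widetilde s_0=\max\{s_0,\log(T)/\log(G)\}$ and $$\widetilde\phi(s)=\inf\Big\{\frac{\|\mathbf Z\boldsymbol\theta\|_2^2}{\|\mathbf Z\|_o^2\|\boldsymbol\theta\|_2^2}:\ \boldsymbol\theta\neq\mathbf 0,\ s_{\boldsymbol\theta}\le s\Big\}.$$ Let $0<\underline\sigma^2\le\overline\sigma^2$, $c_g,c_{\boldsymbol\theta},c_{\pi_0},u,\underline d>0$ and $1<\underline c<\overline C$ be constants not depending on $T$, and suppose that for all large $T$: 1. $\max_j g_j\le c_g\log(G)/\log(T)$; 2. $\|\mathbf Z\|_o/\sqrt T<\sqrt{\log T}$ and $\|\mathbf Z\|_o\,\underline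 c/\sqrt T\le\lambda_j\le\overline C\min\{\sqrt{\log T},\sqrt{\log G}\,\|\mathbf Z\|_o\}$ for all $j\le G$; 3. $\frac{d+j-1}{c+G-j}\le\frac{j}{G^u(G-j+1)}$ for all $j\in\{1,\dots,G\}$, $\underline d\le d\le s_0$, and $\log(G+c)\le c_{\pi_0}\log G$; and that $\epsilon\to0$ as $T\to\infty$. Let $\overline\Theta_0$ be the set of $\boldsymbol\theta_0\in\mathbb R^{\widetilde g}$ with $\|\boldsymbol\theta_0\|_\infty\le c_{\boldsymbol\theta}\sqrt{\log G}$ and exactly $s_0$ nonzero groups. Then, for every sufficiently large constant $M_2>0$ and every sufficiently large $M>0$ (how large depends only on the constants above and, for $M$, on $M_2$), $$\sup_{\boldsymbol\theta_0\in\overline\Theta_0,\ \sigma_0^2\in[\underline\sigma^2,\overline\sigma^2]}\mathbf E_0\left[\Pi\left(\boldsymbol\theta:\ \|\boldsymbol\theta-\boldsymbol\theta_0\|_2^2\ge\frac{M\,T\epsilon^2}{\widetilde\phi(s_0+M_2\widetilde s_0)\,\|\mathbf Z\|_o^2}\,\Big|\,y,\mathbf Z\right)\right]\longrightarrow0\qquad(T\to\infty),$$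 where $\mathbf E_0$ is the expectation over $y\sim\mathcal N_T(\mathbf Z\boldsymbol\theta_0,\sigma_0^2\mathbf I_T)$ and the radius is $+\infty$ when $\widetilde\phi(s_0+M_2\widetilde s_0)=0$. -/

import Mathlib

open MeasureTheory ProbabilityTheory Filter Topology
open scoped ENNReal NNReal

noncomputable section

/-- Coefficient vectors `θ = (θ_1, …, θ_G)` made of `G` groups, the `j`-th one in `ℝ^{g_j}`. -/
abbrev Coef {G : ℕ} (g : Fin G → ℕ) : Type := (j : Fin G) → EuclideanSpace ℝ (Fin (g j))

/-- Design matrices with `T` rows whose columns are partitioned into `G` groups of sizes `g_j`. -/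
abbrev Design (T : ℕ) {G : ℕ} (g : Fin G → ℕ) : Type :=
  Matrix (Fin T) ((j : Fin G) × Fin (g j)) ℝ

/-- The vector `Z θ ∈ ℝ^T`. -/
def Design.fit {T G : ℕ} {g : Fin G → ℕ} (Z : Design T g) (θ : Coef g) : Fin T → ℝ :=
  Z.mulVec (fun p => θ p.1 p.2)

/-- The `T × g_j` submatrix `Z_j` of the columns in the `j`-th group. -/
def Design.block {T G : ℕ} {g : Fin G → ℕ} (Z : Design T g) (j : Fin G) :
    Matrix (Fin T) (Fin (g j)) ℝ :=
  Z.submatrix id (fun i => ⟨j, i⟩)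

/-- Spectral norm of a rectangular matrix. -/
def matSpectralNorm {m n : ℕ} (A : Matrix (Fin m) (Fin n) ℝ) : ℝ :=
  ‖LinearMap.toContinuousLinearMap (Matrix.toEuclideanLin A)‖

/-- `‖Z‖_o`, the largest of the spectral norms of the blocks `Z_1, …, Z_G`. -/
def Design.groupNorm {T G : ℕ} {g : Fin G → ℕ} (Z : Design T g) : ℝ :=
  ⨆ j : Fin G, matSpectralNorm (Z.block j)

/-- The squared Euclidean norm `‖θ‖_2²`. -/
def normSq {G : ℕ} {g : Fin G → ℕ} (θ : Coef g) : ℝ := ∑ j, ‖θ j‖ ^ 2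

open Classical in
/-- The number `s_θ` of nonzero groups of `θ`. -/
def numActive {G : ℕ} {g : Fin G → ℕ} (θ : Coef g) : ℕ :=
  (Finset.univ.filter (fun j => θ j ≠ 0)).card

/-- The smallest scaled group-sparse singular value `φ̃(s)`: the infimum of
`‖Zθ‖_2² / (‖Z‖_o² ‖θ‖_2²)` over the `θ ≠ 0` with at most `s` nonzero groups. -/
def Design.phi {T G : ℕ} {g : Fin G → ℕ} (Z : Design T g) (s : ℝ) : ℝ≥0∞ :=
  ⨅ (θ : Coef g) (_ : θ ≠ 0) (_ : (numActive θ : ℝ) ≤ s),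
    ENNReal.ofReal (∑ t, Z.fit θ t ^ 2) / ENNReal.ofReal (Z.groupNorm ^ 2 * normSq θ)

/-- The law `N_T(Zθ, v I_T)` of the observations (`v` is the error variance). -/
def dataLaw {T G : ℕ} {g : Fin G → ℕ} (Z : Design T g) (θ : Coef g) (v : ℝ) :
    Measure (Fin T → ℝ) :=
  Measure.pi (fun t => gaussianReal (Z.fit θ t) v.toNNReal)

/-- The Lebesgue density at `y` of `N_T(Zθ, v I_T)`. -/
def likelihood {T G : ℕ} {g : Fin G → ℕ} (Z : Design T g) (y : Fin T → ℝ) (θ : Coef g) (v : ℝ) :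
    ℝ≥0∞ :=
  ∏ t, gaussianPDF (Z.fit θ t) v.toNNReal (y t)

/-- The `n`-dimensional Multi-Laplace density with location `0` and scale `σ / lam`, `σ = √v`:
`(lam/σ)^n exp(-lam ‖x‖_2 / σ)` divided by its integral `Γ((n+1)/2) π^{(n-1)/2} 2^n`. -/
def mLaplacePDF (n : ℕ) (lam v : ℝ) (x : EuclideanSpace ℝ (Fin n)) : ℝ≥0∞ :=
  ENNReal.ofReal
    ((lam / √v) ^ n * Real.exp (-(lam / √v) * ‖x‖)
      / (Real.Gamma (((n : ℝ) + 1) / 2) * Real.pi ^ (((n : ℝ) - 1) / 2) * 2 ^ n))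

/-- The spike-and-slab prior of one group given the variance `v` and the spike weight `p`:
`(1 - p) M-Laplace(0, √v / lam) + p δ_0`. -/
def groupPrior (n : ℕ) (lam v p : ℝ) : Measure (EuclideanSpace ℝ (Fin n)) :=
  ENNReal.ofReal (1 - p) • (volume : Measure (EuclideanSpace ℝ (Fin n))).withDensity
      (mLaplacePDF n lam v)
    + ENNReal.ofReal p • Measure.dirac 0

/-- The prior of `θ` given `v` and `p`: independent groups. -/
def coefPrior {G : ℕ} (g : Fin G → ℕ) (lam : Fin G → ℝ) (v p : ℝ) : Measure (Coef g) :=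
  Measure.pi (fun j => groupPrior (g j) (lam j) v p)

/-- The inverse gamma distribution with shape `a` and scale `b`
(density proportional to `x^{-a-1} e^{-b/x}` on `x > 0`). -/
def invGammaMeasure (a b : ℝ) : Measure ℝ := (gammaMeasure a b).map (fun x => x⁻¹)

/-- The design, the group structure, the prior hyper-parameters and the sparsity level attached to
the sample size `T`. The error variance `σ²` has an inverse gamma prior, the spike weight `π_0` a
Beta(`c`, `d`) prior, and `lam j` is the penalty parameter of group `j`. -/
structure Setup (T : ℕ) where
  /-- number of groups -/
  G : ℕ
  /-- group sizes -/
  g : Fin G → ℕ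
  /-- groups are nonempty -/
  g_pos : ∀ j, 0 < g j
  /-- design matrix -/
  Z : Design T g
  /-- penalty parameters -/
  lam : Fin G → ℝ
  lam_pos : ∀ j, 0 < lam j
  /-- first Beta hyper-parameter -/
  c : ℝ
  c_pos : 0 < c
  /-- second Beta hyper-parameter -/
  d : ℝ
  d_pos : 0 < d
  /-- number of nonzero groups of the true coefficient vector -/
  s0 : ℕ

namespace Setup

variable {T : ℕ}

/-- `∫ L(y; θ, σ²) 1_B(θ) dΠ(θ, σ²)`, where `Π` is the prior
`π_0 ~ Beta(c, d)`, `σ² ~ Inv-Gamma(a1, b1)` independent, and `θ` given `(σ², π_0)` spike-and-slab. -/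
def jointMass (X : Setup T) (a1 b1 : ℝ) (y : Fin T → ℝ) (B : Set (Coef X.g)) : ℝ≥0∞ :=
  ∫⁻ p, ∫⁻ v, ∫⁻ θ in B, likelihood X.Z y θ v ∂(coefPrior X.g X.lam v p)
    ∂(invGammaMeasure a1 b1) ∂(betaMeasure X.c X.d)

/-- The marginal posterior probability `Π(θ ∈ B | y, Z)`, by Bayes' formula. -/
def posterior (X : Setup T) (a1 b1 : ℝ) (y : Fin T → ℝ) (B : Set (Coef X.g)) : ℝ≥0∞ :=
  X.jointMass a1 b1 y B / X.jointMass a1 b1 y Set.univ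

/-- The rate `ε = max{√(s_0 log G / T), √(log T / T)}`. -/
def eps (X : Setup T) : ℝ :=
  max (√(X.s0 * Real.log X.G / T)) (√(Real.log T / T))

/-- `s̃_0 = max{s_0, log T / log G}`. -/
def sTilde (X : Setup T) : ℝ := max (X.s0 : ℝ) (Real.log T / Real.log X.G)

/-- The radius `M T ε² / (φ̃(s_0 + M₂ s̃_0) ‖Z‖_o²)`, which is `∞` if `φ̃(s_0 + M₂ s̃_0) = 0`. -/
def radius (X : Setup T) (M M₂ : ℝ) : ℝ≥0∞ :=
  ENNReal.ofReal (M * T * X.eps ^ 2)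
    / (X.Z.phi (X.s0 + M₂ * X.sTilde) * ENNReal.ofReal (X.Z.groupNorm ^ 2))

/-- The true coefficient vectors: `‖θ_0‖_∞ ≤ cθ √(log G)`, with exactly `s_0` nonzero groups. -/
def trueCoef (X : Setup T) (cθ : ℝ) : Set (Coef X.g) :=
  {θ₀ | (∀ j i, |θ₀ j i| ≤ cθ * √(Real.log X.G)) ∧ numActive θ₀ = X.s0}

/-- Growth of the largest group size. -/
def GroupSizeCond (X : Setup T) (cg : ℝ) : Prop :=
  ∀ j, (X.g j : ℝ) ≤ cg * Real.log X.G / Real.log T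

/-- Size of the design and range of the penalty parameters. -/
def PenaltyCond (X : Setup T) (clo Chi : ℝ) : Prop :=
  X.Z.groupNorm / √(T : ℝ) < √(Real.log T) ∧
  ∀ j, X.Z.groupNorm * clo / √(T : ℝ) ≤ X.lam j ∧
    X.lam j ≤ Chi * min (√(Real.log T)) (√(Real.log X.G) * X.Z.groupNorm)

/-- The conditions on the hyper-parameters of the Beta prior. -/
def BetaCond (X : Setup T) (u dlo cπ : ℝ) : Prop :=
  (∀ j ∈ Finset.Icc 1 X.G,
    (X.d + j - 1) / (X.c + X.G - j) ≤ j / ((X.G : ℝ) ^ u * (X.G - j + 1))) ∧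
  dlo ≤ X.d ∧ X.d ≤ X.s0 ∧
  Real.log (X.G + X.c) ≤ cπ * Real.log X.G

end Setup

end

/-! By Bayes' formula the posterior mass of the far set `B` is a ratio of integrated likelihoods,
both of which can be measured in units of the likelihood at the truth. No tests and no sieve on the
variance are needed.

Evidence (`exists_evidence_const`): the prior charges a tiny neighbourhood of the truth, with the
right active groups and a variance within a factor `1 + 1 / T`, by at least `exp (-C s₀ log G)`. The
likelihood there is comparable to the true one as soon as the true residual sum of squares is of its
expected size.

Numerator, many active groups: under the truth a likelihood ratio has expectation one, so the
expected contribution is at most a prior probability (`lintegral_jointMass_div_le`). The Beta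
condition makes the prior of the model size decay geometrically with ratio `G ^ (-u)`
(`sizePrior_succ_le`), and `M₂` large makes this beat the evidence bound.

Numerator, few active groups but far from the truth: `φ̃` converts estimation error into prediction
error at least `M T ε²`. A Gaussian projection bound, uniform over all unions of few groups
(`dataLaw_cross_tail`), shows that the noise cancels at most half of it. Even after maximising over
the variance (`gaussLogLik_le`), the likelihood is then below the true one by a factor `exp (-(M /
(8 vhi) - 1) T ε²)`, which beats the evidence for `M` large.

The exceptional events have probability at most a constant over `log T` (Chebyshev for the residual
sum of squares) plus `1 / G`, and `log G ≥ log T / cg` makes everything vanish uniformly in the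
truth. -/

/-! ### Gaussian tail bounds. -/

/-- The law of a vector of `n` independent standard normal variables. -/
noncomputable abbrev stdNormal (n : ℕ) : Measure (Fin n → ℝ) :=
  Measure.pi (fun _ => gaussianReal 0 1)

lemma lintegral_pi_prod {ι : Type*} [Fintype ι] {Ω : ι → Type*} [∀ i, MeasurableSpace (Ω i)]
    (μ : (i : ι) → Measure (Ω i)) [∀ i, IsProbabilityMeasure (μ i)]
    (f : (i : ι) → Ω i → ℝ≥0∞) (hf : ∀ i, Measurable (f i)) :
    ∫⁻ x, ∏ i, f i (x i) ∂(Measure.pi μ) = ∏ i, ∫⁻ x, f i x ∂(μ i) := by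
  refine (lintegral_prod_eq_prod_lintegral_of_indepFun Finset.univ
    (fun i (x : (i : ι) → Ω i) => f i (x i))
    (iIndepFun_pi fun i => (hf i).aemeasurable)
    (fun i => (hf i).comp (measurable_pi_apply i))).trans ?_
  refine Finset.prod_congr rfl fun i _ => ?_
  rw [← (measurePreserving_eval μ i).lintegral_comp (hf i)]

lemma dataLaw_eq_map {T G : ℕ} {g : Fin G → ℕ} (Z : Design T g) (θ : Coef g) {v : ℝ} (hv : 0 ≤ v) :
    dataLaw Z θ v = (stdNormal T).map (fun z t => Z.fit θ t + √v * z t) := by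
  rw [dataLaw, Measure.pi_map_pi (f := fun t x => Z.fit θ t + √v * x)
    (fun t => (by fun_prop : Measurable _).aemeasurable)]
  congr 1
  funext t
  have h : (fun x : ℝ => Z.fit θ t + √v * x) = (fun x => Z.fit θ t + x) ∘ (fun x => √v * x) := rfl
  rw [h, ← Measure.map_map (by fun_prop) (by fun_prop), gaussianReal_map_const_mul,
    gaussianReal_map_const_add]
  congr 1
  · simp
  · ext; simp [Real.sq_sqrt hv, hv]

/-- Chebyshev's inequality. The variance of a squared normal variable enters only as a fixed
constant, so it is never evaluated. -/
lemma stdNormal_meanSq_tail {n : ℕ} (hn : 0 < n) {ε : ℝ} (hε : 0 < ε) :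
    stdNormal n {z | ε ≤ |(∑ t, z t ^ 2) / n - 1|} ≤
      ENNReal.ofReal (Var[fun x : ℝ => x ^ 2; gaussianReal 0 1] / (n * ε ^ 2)) := by
  have hn' : (0 : ℝ) < n := by exact_mod_cast hn
  have hL : MemLp (fun x : ℝ => x ^ 2) 2 (gaussianReal 0 1) := by
    have h4 : MemLp (id : ℝ → ℝ) 4 (gaussianReal 0 1) := memLp_id_gaussianReal' 4 (by simp)
    have := h4.norm_rpow_div (q := 2)
    have e : (4 : ℝ≥0∞) / 2 = 2 := by
      rw [show (4 : ℝ≥0∞) = 2 * 2 by norm_num, ENNReal.mul_div_cancel_right (by simp) (by simp)]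
    rw [e] at this
    refine this.congr_norm (by fun_prop) (ae_of_all _ fun x => ?_)
    simp
  set X : (Fin n → ℝ) → ℝ := ∑ i : Fin n, fun z => (fun x : ℝ => x ^ 2) (z i) with hX
  have hXi : ∀ i : Fin n, MemLp (fun z : Fin n → ℝ => (z i) ^ 2) 2 (stdNormal n) := fun i =>
    hL.comp_measurePreserving (measurePreserving_eval (fun _ => gaussianReal 0 1) i)
  have hXL : MemLp X 2 (stdNormal n) := by
    rw [hX]; exact memLp_finsetSum' _ fun i _ => hXi i
  have hvar : Var[X; stdNormal n] = n * Var[fun x : ℝ => x ^ 2; gaussianReal 0 1] := by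
    rw [hX, variance_sum_pi (fun _ => hL)]; simp
  have h2 : ∫ x, x ^ 2 ∂(gaussianReal 0 1) = 1 := by
    have := variance_fun_id_gaussianReal (μ := 0) (v := 1)
    rw [variance_eq_integral (by fun_prop)] at this
    simpa using this
  have hmean : (∫ z, X z ∂(stdNormal n)) = (n : ℝ) := by
    have : ∀ z, X z = ∑ i : Fin n, (z i) ^ 2 := fun z => by simp [hX]
    simp_rw [this]
    rw [integral_finsetSum _ fun i _ => (hXi i).integrable (by norm_num)]
    have : ∀ i : Fin n, ∫ z, (z i) ^ 2 ∂(stdNormal n) = 1 := fun i => by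
      rw [← h2]
      have hm := (measurePreserving_eval (fun _ : Fin n => gaussianReal 0 1) i).map_eq
      conv_rhs => rw [← hm]
      rw [integral_map (measurable_pi_apply i).aemeasurable (by fun_prop)]
    simp [this]
  have := meas_ge_le_variance_div_sq hXL (mul_pos hn' hε)
  rw [hmean, hvar] at this
  refine (measure_mono fun z hz => ?_).trans (this.trans (le_of_eq ?_))
  · simp only [Set.mem_ofPred_eq] at hz ⊢
    have e : X z - n = n * ((∑ t, z t ^ 2) / n - 1) := by
      simp only [hX, Finset.sum_apply]; field_simp
    rw [e, abs_mul, abs_of_pos hn']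
    gcongr
  · congr 1; field_simp

/-- Tilting the density of N(0, 1) by `exp (x ^ 2 / 4)` gives `√2` times the density of N(0, 2). -/
lemma lintegral_exp_sq_div_four :
    ∫⁻ x, ENNReal.ofReal (Real.exp (x ^ 2 / 4)) ∂(gaussianReal 0 1) = ENNReal.ofReal (√2) := by
  rw [gaussianReal_of_var_ne_zero _ one_ne_zero,
    lintegral_withDensity_eq_lintegral_mul _ (measurable_gaussianPDF 0 1) (by fun_prop)]
  have h : ∀ x : ℝ, (gaussianPDF 0 1 * fun x => ENNReal.ofReal (Real.exp (x ^ 2 / 4))) x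
      = ENNReal.ofReal (√2) * gaussianPDF 0 2 x := by
    intro x
    simp only [Pi.mul_apply, gaussianPDF, gaussianPDFReal]
    rw [← ENNReal.ofReal_mul (by positivity), ← ENNReal.ofReal_mul (by positivity)]
    congr 1
    rw [mul_assoc, ← Real.exp_add, ← mul_assoc]
    congr 1
    · push_cast
      rw [show 2 * Real.pi * 2 = 2 * (2 * Real.pi * 1) by ring, Real.sqrt_mul (by norm_num) (2 * _ * 1)]
      have : √2 ≠ 0 := by positivity
      have : √(2 * Real.pi * 1) ≠ 0 := by positivity
      field_simp
    · congr 1; push_cast; ring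
  rw [lintegral_congr h, lintegral_const_mul _ (measurable_gaussianPDF 0 2),
    lintegral_gaussianPDF_eq_one _ (by norm_num), mul_one]

lemma lintegral_exp_normSq_stdGaussian (E : Type*) [NormedAddCommGroup E] [InnerProductSpace ℝ E]
    [FiniteDimensional ℝ E] [MeasurableSpace E] [BorelSpace E] :
    ∫⁻ x, ENNReal.ofReal (Real.exp (‖x‖ ^ 2 / 4)) ∂(stdGaussian E)
      = ENNReal.ofReal (√2) ^ Module.finrank ℝ E := by
  rw [stdGaussian, lintegral_map (by fun_prop) (by fun_prop)]
  have h : ∀ x : Fin (Module.finrank ℝ E) → ℝ,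
      ENNReal.ofReal (Real.exp (‖∑ i, x i • stdOrthonormalBasis ℝ E i‖ ^ 2 / 4))
        = ∏ i, ENNReal.ofReal (Real.exp (x i ^ 2 / 4)) := by
    intro x
    rw [← ENNReal.ofReal_prod_of_nonneg (fun _ _ => by positivity), ← Real.exp_sum,
      ← Finset.sum_div]
    congr 3
    rw [← real_inner_self_eq_norm_sq,
      (stdOrthonormalBasis ℝ E).orthonormal.inner_sum]
    simp [sq]
  rw [lintegral_congr h, lintegral_pi_prod _ (fun _ x => ENNReal.ofReal (Real.exp (x ^ 2 / 4)))
    (fun _ => by fun_prop)]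
  simp [lintegral_exp_sq_div_four]

/-- The characteristic functions agree, because the projection is self-adjoint and fixes `V`. -/
lemma stdGaussian_map_orthogonalProjection {E : Type*} [NormedAddCommGroup E]
    [InnerProductSpace ℝ E] [FiniteDimensional ℝ E] [MeasurableSpace E] [BorelSpace E]
    (V : Submodule ℝ E) :
    (stdGaussian E).map V.orthogonalProjectionOnto = stdGaussian V := by
  apply Measure.ext_of_charFun
  ext t
  rw [charFun_stdGaussian, charFun_apply, integral_map (by fun_prop) (by fun_prop)]
  have : ∀ x : E, inner ℝ (V.orthogonalProjectionOnto x) t = inner ℝ x (t : E) := fun x => by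
    change inner ℝ (V.starProjection x) (t : E) = _
    rw [Submodule.inner_starProjection_left_eq_right,
      Submodule.starProjection_eq_self_iff.mpr t.2]
  simp_rw [this]
  rw [← charFun_apply, charFun_stdGaussian]
  simp

/-- The projection of a standard normal vector to a subspace `V` has norm of order `√(dim V)`. -/
lemma stdNormal_subspace_tail {n : ℕ} (V : Submodule ℝ (EuclideanSpace ℝ (Fin n))) (R : ℝ) :
    stdNormal n {z | ∃ x ∈ V, R * ‖x‖ ^ 2 < (inner ℝ (WithLp.toLp 2 z) x) ^ 2} ≤
      ENNReal.ofReal (Real.exp (-R / 4)) * ENNReal.ofReal (√2) ^ Module.finrank ℝ V := by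
  set A : Set V := {x | R ≤ ‖x‖ ^ 2} with hA
  have hAm : MeasurableSet A := measurableSet_le (by fun_prop) (by fun_prop)
  have h1 : stdNormal n {z | ∃ x ∈ V, R * ‖x‖ ^ 2 < (inner ℝ (WithLp.toLp 2 z) x) ^ 2}
      ≤ stdGaussian V A := by
    rw [← stdGaussian_map_orthogonalProjection, Measure.map_apply (by fun_prop) hAm,
      ← map_pi_eq_stdGaussian, Measure.map_apply (by fun_prop)
        (hAm.preimage (by fun_prop))]
    refine measure_mono ?_
    rintro z ⟨x, hx, h⟩
    simp only [hA, Set.mem_preimage, Set.mem_ofPred_eq]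
    set w : EuclideanSpace ℝ (Fin n) := WithLp.toLp 2 z
    have e : inner ℝ w x = inner ℝ (V.orthogonalProjectionOnto w) (⟨x, hx⟩ : V) := by
      change _ = inner ℝ (V.starProjection w) x
      rw [Submodule.inner_starProjection_left_eq_right,
        Submodule.starProjection_eq_self_iff.mpr hx]
    -- Cauchy–Schwarz after moving the projection onto `w`: a supremum over all of `V` is controlled
    -- by one projected norm.
    have hc : (inner ℝ w x) ^ 2 ≤ ‖V.orthogonalProjectionOnto w‖ ^ 2 * ‖x‖ ^ 2 := by
      rw [e, ← mul_pow]
      exact sq_le_sq' (abs_le.mp (abs_real_inner_le_norm (V.orthogonalProjectionOnto w)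
        (⟨x, hx⟩ : V))).1 (real_inner_le_norm _ _)
    by_contra hcon
    push Not at hcon
    have := h.trans_le hc
    nlinarith [sq_nonneg ‖x‖]
  refine h1.trans ?_
  -- Exponential Markov inequality; the moment of order 1/4 costs a factor `√2` per dimension.
  have h2 := mul_meas_ge_le_lintegral (μ := stdGaussian V)
    (f := fun x : V => ENNReal.ofReal (Real.exp (‖x‖ ^ 2 / 4))) (by fun_prop)
    (ENNReal.ofReal (Real.exp (R / 4)))
  rw [lintegral_exp_normSq_stdGaussian] at h2
  have h3 : stdGaussian V A ≤ stdGaussian V {x | ENNReal.ofReal (Real.exp (R / 4)) ≤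
      ENNReal.ofReal (Real.exp (‖x‖ ^ 2 / 4))} := by
    refine measure_mono fun x hx => ?_
    simp only [hA, Set.mem_ofPred_eq] at hx ⊢
    gcongr
  calc stdGaussian V A = ENNReal.ofReal (Real.exp (-R / 4)) *
        (ENNReal.ofReal (Real.exp (R / 4)) * stdGaussian V A) := by
        rw [← mul_assoc, ← ENNReal.ofReal_mul (by positivity), ← Real.exp_add]
        simp [neg_div]
    _ ≤ _ := by gcongr; exact (by gcongr : _ ≤ _).trans h2

/-! ### The Multi-Laplace density and the prior of one group. -/

/-- Legendre's duplication formula. The right-hand side is the volume of the unit ball times `n!`, a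
form in which ball volumes cancel. -/
lemma mLaplace_const_eq (n : ℕ) :
    Real.Gamma (((n : ℝ) + 1) / 2) * Real.pi ^ (((n : ℝ) - 1) / 2) * 2 ^ n
      = √Real.pi ^ n / Real.Gamma ((n : ℝ) / 2 + 1) * n.factorial := by
  have hG : 0 < Real.Gamma ((n : ℝ) / 2 + 1) := Real.Gamma_pos_of_pos (by positivity)
  have hd := Real.Gamma_mul_Gamma_add_half (((n : ℝ) + 1) / 2)
  rw [show ((n : ℝ) + 1) / 2 + 1 / 2 = (n : ℝ) / 2 + 1 by ring,
    show 2 * (((n : ℝ) + 1) / 2) = n + 1 by ring, Real.Gamma_nat_eq_factorial,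
    show (1 : ℝ) - (n + 1) = -n by ring, Real.rpow_neg (by norm_num), Real.rpow_natCast] at hd
  have hp : Real.pi ^ (((n : ℝ) - 1) / 2) * √Real.pi = √Real.pi ^ n := by
    rw [Real.sqrt_eq_rpow, ← Real.rpow_add Real.pi_pos, ← Real.rpow_natCast,
      ← Real.rpow_mul Real.pi_pos.le]
    congr 1; ring
  rw [div_mul_eq_mul_div, eq_div_iff hG.ne', ← hp]
  calc _ = (Real.Gamma (((n : ℝ) + 1) / 2) * Real.Gamma ((n : ℝ) / 2 + 1))
        * Real.pi ^ (((n : ℝ) - 1) / 2) * 2 ^ n := by ring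
    _ = _ := by rw [hd]; field_simp

lemma mLaplace_const_pos (n : ℕ) :
    0 < Real.Gamma (((n : ℝ) + 1) / 2) * Real.pi ^ (((n : ℝ) - 1) / 2) * 2 ^ n := by
  have : 0 < Real.Gamma (((n : ℝ) + 1) / 2) := Real.Gamma_pos_of_pos (by positivity)
  have := Real.rpow_pos_of_pos Real.pi_pos (((n : ℝ) - 1) / 2)
  positivity

lemma integral_exp_neg_norm {n : ℕ} (hn : 0 < n) :
    ∫ x : EuclideanSpace ℝ (Fin n), Real.exp (-‖x‖)
      = Real.Gamma (((n : ℝ) + 1) / 2) * Real.pi ^ (((n : ℝ) - 1) / 2) * 2 ^ n := by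
  have : Nonempty (Fin n) := ⟨⟨0, hn⟩⟩
  have h := MeasureTheory.measure_unitBall_eq_integral_div_gamma
    (volume : Measure (EuclideanSpace ℝ (Fin n))) (p := 1) one_pos
  rw [EuclideanSpace.volume_ball] at h
  simp only [Fintype.card_fin, ENNReal.ofReal_one, one_pow, one_mul, Real.rpow_one,
    finrank_euclideanSpace, div_one, Real.Gamma_nat_eq_factorial] at h
  have hG : 0 < Real.Gamma ((n : ℝ) / 2 + 1) := Real.Gamma_pos_of_pos (by positivity)
  rw [ENNReal.ofReal_eq_ofReal_iff (by positivity)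
    (div_nonneg (integral_nonneg fun _ => (Real.exp_pos _).le) (by positivity))] at h
  rw [mLaplace_const_eq, h]
  field_simp

lemma measurable_mLaplacePDF (n : ℕ) (lam v : ℝ) : Measurable (mLaplacePDF n lam v) := by
  unfold mLaplacePDF
  fun_prop

lemma lintegral_mLaplacePDF {n : ℕ} (hn : 0 < n) {lam v : ℝ} (hl : 0 < lam) (hv : 0 < v) :
    ∫⁻ x, mLaplacePDF n lam v x = 1 := by
  set a := lam / √v with ha
  have ha0 : 0 < a := div_pos hl (Real.sqrt_pos.mpr hv)
  set K := Real.Gamma (((n : ℝ) + 1) / 2) * Real.pi ^ (((n : ℝ) - 1) / 2) * 2 ^ n with hK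
  have hK0 : 0 < K := mLaplace_const_pos n
  have hI : ∫ x : EuclideanSpace ℝ (Fin n), Real.exp (-‖x‖) = K := integral_exp_neg_norm hn
  have hint : ∫ x : EuclideanSpace ℝ (Fin n), a ^ n * Real.exp (-a * ‖x‖) / K = 1 := by
    have h := Measure.integral_comp_smul (volume : Measure (EuclideanSpace ℝ (Fin n)))
      (fun x => Real.exp (-‖x‖)) a
    rw [hI, finrank_euclideanSpace, Fintype.card_fin, abs_of_pos (by positivity), smul_eq_mul] at h
    have e : ∀ x : EuclideanSpace ℝ (Fin n), a ^ n * Real.exp (-a * ‖x‖) / K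
        = a ^ n / K * Real.exp (-‖a • x‖) := fun x => by
      rw [norm_smul, Real.norm_of_nonneg ha0.le]; ring_nf
    simp_rw [e]
    rw [integral_const_mul, h]
    field_simp
  -- A non-integrable function would have Bochner integral 0 by convention, not 1.
  have hint' : Integrable (fun x : EuclideanSpace ℝ (Fin n) => a ^ n * Real.exp (-a * ‖x‖) / K) := by
    by_contra hc
    rw [integral_undef hc] at hint
    norm_num at hint
  have : ∀ x, mLaplacePDF n lam v x = ENNReal.ofReal (a ^ n * Real.exp (-a * ‖x‖) / K) :=
    fun x => rfl
  simp_rw [this]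
  rw [← ofReal_integral_eq_lintegral_ofReal hint' (ae_of_all _ fun x => by positivity), hint,
    ENNReal.ofReal_one]

/-- On the ball the density is at least its value at norm `‖x₀‖ + r`. The volume of the ball cancels
against the normalising constant and leaves only `n!`. -/
lemma mLaplace_closedBall_ge {n : ℕ} (hn : 0 < n) {lam v r : ℝ} (hl : 0 < lam) (hv : 0 < v)
    (hr : 0 < r) (x₀ : EuclideanSpace ℝ (Fin n)) :
    ENNReal.ofReal ((lam / √v * r) ^ n / n.factorial * Real.exp (-(lam / √v) * (‖x₀‖ + r))) ≤
      (volume.withDensity (mLaplacePDF n lam v)) (Metric.closedBall x₀ r) := by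
  have : Nonempty (Fin n) := ⟨⟨0, hn⟩⟩
  set a := lam / √v with ha
  have ha0 : 0 < a := div_pos hl (Real.sqrt_pos.mpr hv)
  have hG : 0 < Real.Gamma ((n : ℝ) / 2 + 1) := Real.Gamma_pos_of_pos (by positivity)
  have hpi : 0 < √Real.pi ^ n := by positivity
  rw [withDensity_apply _ Metric.isClosed_closedBall.measurableSet]
  calc _ = ∫⁻ x in Metric.closedBall x₀ r, ENNReal.ofReal (a ^ n * Real.exp (-a * (‖x₀‖ + r))
        / (Real.Gamma (((n : ℝ) + 1) / 2) * Real.pi ^ (((n : ℝ) - 1) / 2) * 2 ^ n)) := by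
        rw [setLIntegral_const, EuclideanSpace.volume_closedBall, Fintype.card_fin,
          ← ENNReal.ofReal_pow hr.le, ← ENNReal.ofReal_mul (by positivity),
          ← ENNReal.ofReal_mul (by rw [mLaplace_const_eq]; positivity), mLaplace_const_eq]
        congr 1
        rw [mul_pow]
        field_simp
    _ ≤ _ := by
        refine setLIntegral_mono (measurable_mLaplacePDF n lam v) fun x hx => ?_
        unfold mLaplacePDF
        apply ENNReal.ofReal_le_ofReal
        have hx' : ‖x‖ ≤ ‖x₀‖ + r := by
          have h1 : ‖x - x₀‖ ≤ r := by simpa [dist_eq_norm] using hx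
          have h2 : ‖x‖ ≤ ‖x₀‖ + ‖x - x₀‖ := by simpa using norm_add_le x₀ (x - x₀)
          linarith
        refine div_le_div_of_nonneg_right ?_ (mLaplace_const_pos n).le
        refine mul_le_mul_of_nonneg_left (Real.exp_le_exp.mpr ?_) (by positivity)
        nlinarith

lemma groupPrior_apply (n : ℕ) (lam v p : ℝ) (A : Set (EuclideanSpace ℝ (Fin n))) :
    groupPrior n lam v p A = ENNReal.ofReal (1 - p) * volume.withDensity (mLaplacePDF n lam v) A
      + ENNReal.ofReal p * Measure.dirac 0 A := by
  simp [groupPrior]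

lemma isProbabilityMeasure_groupPrior {n : ℕ} (hn : 0 < n) {lam v p : ℝ} (hl : 0 < lam) (hv : 0 < v)
    (hp : p ∈ Set.Icc (0 : ℝ) 1) : IsProbabilityMeasure (groupPrior n lam v p) := by
  constructor
  rw [groupPrior_apply, withDensity_apply _ .univ, Measure.restrict_univ,
    lintegral_mLaplacePDF hn hl hv]
  simp only [measure_univ, mul_one]
  rw [← ENNReal.ofReal_add (by linarith [hp.2]) hp.1]
  simp

lemma groupPrior_zero {n : ℕ} (hn : 0 < n) (lam v p : ℝ) :
    groupPrior n lam v p {0} = ENNReal.ofReal p := by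
  have : Nonempty (Fin n) := ⟨⟨0, hn⟩⟩
  have h0 : volume.withDensity (mLaplacePDF n lam v) {0} = 0 :=
    withDensity_absolutelyContinuous _ _ (measure_singleton 0)
  rw [groupPrior_apply, h0]
  simp

lemma groupPrior_compl_zero {n : ℕ} (hn : 0 < n) {lam v : ℝ} (hl : 0 < lam) (hv : 0 < v) (p : ℝ) :
    groupPrior n lam v p {0}ᶜ ≤ ENNReal.ofReal (1 - p) := by
  rw [groupPrior_apply]
  have h1 : volume.withDensity (mLaplacePDF n lam v) {0}ᶜ ≤ 1 := by
    refine (measure_mono (Set.subset_univ _)).trans ?_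
    rw [withDensity_apply _ .univ, Measure.restrict_univ, lintegral_mLaplacePDF hn hl hv]
  simp only [Measure.dirac_apply' _ (measurableSet_singleton (0 : EuclideanSpace ℝ (Fin n))).compl]
  simp only [Set.mem_compl_iff, Set.mem_singleton_iff, not_true_eq_false, not_false_eq_true,
    Set.indicator_of_notMem, mul_zero, add_zero]
  exact mul_le_of_le_one_right' h1

lemma measurable_groupPrior_apply {n : ℕ} (lam : ℝ) {A : Set (EuclideanSpace ℝ (Fin n))}
    (hA : MeasurableSet A) : Measurable fun q : ℝ × ℝ => groupPrior n lam q.2 q.1 A := by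
  simp_rw [groupPrior_apply, withDensity_apply _ hA]
  refine ((by fun_prop : Measurable _).mul (Measurable.lintegral_prod_right' (f := fun z : (ℝ × ℝ) ×
    EuclideanSpace ℝ (Fin n) => mLaplacePDF n lam z.1.2 z.2) ?_)).add (by fun_prop)
  unfold mLaplacePDF
  fun_prop

/-! ### The prior of all groups as a measurable kernel. -/

section CoefPrior

variable {G : ℕ} {g : Fin G → ℕ}

lemma isProbabilityMeasure_coefPrior (hg : ∀ j, 0 < g j) {lam : Fin G → ℝ} (hl : ∀ j, 0 < lam j)
    {v p : ℝ} (hv : 0 < v) (hp : p ∈ Set.Icc (0 : ℝ) 1) :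
    IsProbabilityMeasure (coefPrior g lam v p) := by
  have := fun j => isProbabilityMeasure_groupPrior (hg j) (hl j) hv hp
  unfold coefPrior
  infer_instance

open Classical in
/-- The prior of the coefficients as a kernel, with a default value outside the range of the
hyper-parameters `(p, v)`. -/
noncomputable def coefPriorOr (g : Fin G → ℕ) (lam : Fin G → ℝ) (q : ℝ × ℝ) : Measure (Coef g) :=
  if q.1 ∈ Set.Icc (0 : ℝ) 1 ∧ 0 < q.2 then coefPrior g lam q.2 q.1 else Measure.dirac 0

lemma isProbabilityMeasure_coefPriorOr (hg : ∀ j, 0 < g j) {lam : Fin G → ℝ} (hl : ∀ j, 0 < lam j)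
    (q : ℝ × ℝ) : IsProbabilityMeasure (coefPriorOr g lam q) := by
  unfold coefPriorOr
  split_ifs with h
  · exact isProbabilityMeasure_coefPrior hg hl h.2 h.1
  · infer_instance

/-- Measurability in the hyper-parameters, needed for Tonelli, is checked on the π-system of boxes,
where the mass is a finite product. -/
lemma measurable_coefPriorOr (hg : ∀ j, 0 < g j) {lam : Fin G → ℝ} (hl : ∀ j, 0 < lam j) :
    Measurable (coefPriorOr g lam) := by
  have := isProbabilityMeasure_coefPriorOr hg hl
  refine Measurable.measure_of_isPiSystem_of_isProbabilityMeasure generateFrom_pi.symm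
    isPiSystem_pi ?_
  rintro _ ⟨A, hA, rfl⟩
  simp only [Set.mem_pi, Set.mem_univ, forall_true_left, Set.mem_ofPred_eq] at hA
  have hS : MeasurableSet {q : ℝ × ℝ | q.1 ∈ Set.Icc (0 : ℝ) 1 ∧ 0 < q.2} :=
    (measurable_fst measurableSet_Icc).inter (measurable_snd measurableSet_Ioi)
  classical
  have e : (fun q => coefPriorOr g lam q (Set.univ.pi A)) = fun q : ℝ × ℝ =>
      if q ∈ {q : ℝ × ℝ | q.1 ∈ Set.Icc (0 : ℝ) 1 ∧ 0 < q.2} then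
        ∏ j, groupPrior (g j) (lam j) q.2 q.1 (A j)
      else Measure.dirac 0 (Set.univ.pi A) := by
    funext q
    unfold coefPriorOr
    simp only [Set.mem_ofPred_eq]
    split_ifs with h
    · have := fun j => isProbabilityMeasure_groupPrior (hg j) (hl j) h.2 h.1
      rw [coefPrior, Measure.pi_pi]
    · rfl
  rw [e]
  exact Measurable.ite hS (Finset.measurable_prod _ fun j _ =>
    measurable_groupPrior_apply (lam j) (hA j)) measurable_const

lemma measurableSet_active (P : (Fin G → Prop) → Prop) :
    MeasurableSet {θ : Coef g | P fun j => θ j ≠ 0} := by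
  have h : Measurable fun θ : Coef g => fun j => θ j ≠ 0 := by
    refine measurable_pi_lambda _ fun j => ?_
    refine measurable_to_prop ?_
    have : ((fun θ : Coef g => θ j ≠ 0) ⁻¹' {True}) = {θ : Coef g | θ j = 0}ᶜ := by
      ext; simp
    rw [this]
    exact (measurableSet_eq_fun (measurable_pi_apply j) measurable_const).compl
  exact h (Set.to_countable {f | P f}).measurableSet

open Classical in
lemma measurableSet_lt_numActive (k : ℝ) : MeasurableSet {θ : Coef g | k < (numActive θ : ℝ)} := by
  have h := measurableSet_active (g := g)
    (fun f => k < ((Finset.univ.filter (fun j => f j)).card : ℝ))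
  unfold numActive
  convert h


end CoefPrior

/-! ### Beta moments and the prior of the number of active groups. -/

lemma ae_betaMeasure_mem (c d : ℝ) : ∀ᵐ p ∂(betaMeasure c d), p ∈ Set.Ioo (0 : ℝ) 1 := by
  rw [betaMeasure, ae_withDensity_iff (by unfold betaPDF; fun_prop)]
  refine ae_of_all _ fun p hp => ?_
  by_contra hc
  exact hp (by rw [betaPDF_eq, if_neg (by simpa using hc), ENNReal.ofReal_zero])

/-- The expectation of `p ^ m * (1 - p) ^ s` when `p` has a Beta(`c`, `d`) distribution. -/
noncomputable def betaMoment (c d : ℝ) (m s : ℕ) : ℝ := beta (c + m) (d + s) / beta c d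

lemma betaMoment_pos {c d : ℝ} (hc : 0 < c) (hd : 0 < d) (m s : ℕ) : 0 < betaMoment c d m s :=
  div_pos (beta_pos (by positivity) (by positivity)) (beta_pos hc hd)

lemma lintegral_betaMeasure_pow {c d : ℝ} (hc : 0 < c) (hd : 0 < d) (m s : ℕ) :
    ∫⁻ p, ENNReal.ofReal (p ^ m * (1 - p) ^ s) ∂(betaMeasure c d)
      = ENNReal.ofReal (betaMoment c d m s) := by
  have hb := beta_pos hc hd
  have hb' : 0 < beta (c + m) (d + s) := beta_pos (by positivity) (by positivity)
  rw [betaMeasure, lintegral_withDensity_eq_lintegral_mul _ (by unfold betaPDF; fun_prop)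
    (by fun_prop)]
  have h : ∀ p : ℝ, (betaPDF c d * fun p => ENNReal.ofReal (p ^ m * (1 - p) ^ s)) p
      = ENNReal.ofReal (betaMoment c d m s) * betaPDF (c + m) (d + s) p := by
    intro p
    simp only [Pi.mul_apply, betaPDF_eq]
    split_ifs with hp
    · have hp1 : 0 < 1 - p := by linarith [hp.2]
      have hp0 := hp.1
      rw [← ENNReal.ofReal_mul (by positivity), ← ENNReal.ofReal_mul (betaMoment_pos hc hd m s).le,
        betaMoment]
      congr 1
      rw [show c + m - 1 = (c - 1) + m by ring, show d + s - 1 = (d - 1) + s by ring,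
        Real.rpow_add hp0, Real.rpow_add hp1, Real.rpow_natCast, Real.rpow_natCast]
      field_simp
    · simp
  rw [lintegral_congr h, lintegral_const_mul _ (by unfold betaPDF; fun_prop),
    lintegral_betaPDF_eq_one (by positivity) (by positivity), mul_one]

/-- The functional equation of Γ; the ratio produced here is the one bounded by the Beta condition
with `j = s + 1`. -/
lemma betaMoment_succ {c d : ℝ} (hc : 0 < c) (hd : 0 < d) (m s : ℕ) :
    betaMoment c d m (s + 1) = betaMoment c d (m + 1) s * ((d + s) / (c + m)) := by
  have hb := beta_pos hc hd
  have h1 : 0 < c + m := by positivity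
  have h2 : 0 < d + s := by positivity
  have h3 := Real.Gamma_pos_of_pos (show 0 < c + m + (d + s) + 1 by positivity)
  unfold betaMoment beta
  push_cast
  rw [show d + ((s : ℝ) + 1) = d + s + 1 by ring, show c + ((m : ℝ) + 1) = c + m + 1 by ring,
    Real.Gamma_add_one h2.ne', Real.Gamma_add_one h1.ne',
    show c + m + (d + s + 1) = c + m + (d + s) + 1 by ring,
    show c + m + 1 + (d + s) = c + m + (d + s) + 1 by ring]
  field_simp

/-- The prior probability of `s` nonzero groups out of `G`. -/
noncomputable def sizePrior (c d : ℝ) (G s : ℕ) : ℝ := G.choose s * betaMoment c d (G - s) s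

lemma sizePrior_nonneg {c d : ℝ} (hc : 0 < c) (hd : 0 < d) (G s : ℕ) : 0 ≤ sizePrior c d G s :=
  mul_nonneg (by positivity) (betaMoment_pos hc hd _ _).le

/-- The binomial theorem for `(1 - p) + p`, integrated against the Beta law. -/
lemma sum_sizePrior {c d : ℝ} (hc : 0 < c) (hd : 0 < d) (G : ℕ) :
    ∑ s ∈ Finset.range (G + 1), sizePrior c d G s = 1 := by
  have := isProbabilityMeasureBeta hc hd
  have h : ∫⁻ p, ∑ s ∈ Finset.range (G + 1), (G.choose s : ℝ≥0∞) *
      ENNReal.ofReal (p ^ (G - s) * (1 - p) ^ s) ∂(betaMeasure c d) = 1 := by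
    rw [← measure_univ (μ := betaMeasure c d), ← lintegral_one]
    refine lintegral_congr_ae ((ae_betaMeasure_mem c d).mono fun p hp => ?_)
    have hp1 : 0 ≤ 1 - p := by linarith [hp.2]
    have hp0 : 0 ≤ p := hp.1.le
    have := add_pow (1 - p) p G
    rw [show 1 - p + p = 1 by ring, one_pow] at this
    have h2 : ∀ s, (G.choose s : ℝ≥0∞) * ENNReal.ofReal (p ^ (G - s) * (1 - p) ^ s)
        = ENNReal.ofReal ((1 - p) ^ s * p ^ (G - s) * G.choose s) := fun s => by
      rw [← ENNReal.ofReal_natCast, ← ENNReal.ofReal_mul (by positivity)]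
      congr 1; ring
    simp_rw [h2]
    rw [← ENNReal.ofReal_sum_of_nonneg (fun s _ => by positivity), ← this, ENNReal.ofReal_one]
  rw [lintegral_finsetSum _ (fun s _ => by fun_prop)] at h
  have h2 : ∀ s, ∫⁻ p, (G.choose s : ℝ≥0∞) * ENNReal.ofReal (p ^ (G - s) * (1 - p) ^ s)
      ∂(betaMeasure c d) = ENNReal.ofReal (sizePrior c d G s) := fun s => by
    rw [lintegral_const_mul _ (by fun_prop), lintegral_betaMeasure_pow hc hd, sizePrior,
      ENNReal.ofReal_mul (by positivity), ENNReal.ofReal_natCast]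
  simp_rw [h2] at h
  rwa [← ENNReal.ofReal_sum_of_nonneg (fun s _ => sizePrior_nonneg hc hd G s),
    ENNReal.ofReal_eq_one] at h

section Decay

variable {c d u : ℝ} {G : ℕ}

/-- The ratio of consecutive binomial coefficients cancels the factor `j / (G - j + 1)` of the Beta
condition exactly, leaving `G ^ (-u)`. -/
lemma sizePrior_succ_le (hc : 0 < c) (hd : 0 < d)
    (hβ : ∀ j ∈ Finset.Icc 1 G, (d + j - 1) / (c + G - j) ≤ j / ((G : ℝ) ^ u * (G - j + 1)))
    {s : ℕ} (hs : s < G) :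
    sizePrior c d G (s + 1) ≤ (G : ℝ) ^ (-u) * sizePrior c d G s := by
  obtain ⟨m, rfl⟩ : ∃ m, G = s + 1 + m := ⟨G - (s + 1), by omega⟩
  have hG : (0 : ℝ) < ((s + 1 + m : ℕ) : ℝ) ^ u := Real.rpow_pos_of_pos (by positivity) _
  have h := hβ (s + 1) (by simp)
  unfold sizePrior
  have e1 : s + 1 + m - (s + 1) = m := by omega
  have e2 : s + 1 + m - s = m + 1 := by omega
  rw [e1, e2, betaMoment_succ hc hd, Real.rpow_neg (by positivity)]
  have hch : ((s + 1 + m).choose (s + 1) : ℝ) * (s + 1) = (s + 1 + m).choose s * (m + 1) := by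
    have := Nat.choose_succ_right_eq (s + 1 + m) s
    rw [e2] at this
    exact_mod_cast this
  have hm := betaMoment_pos hc hd (m + 1) s
  have h' : (d + s) / (c + m) ≤ (s + 1) / (((s + 1 + m : ℕ) : ℝ) ^ u * (m + 1)) := by
    have a1 : d + ((s + 1 : ℕ) : ℝ) - 1 = d + s := by push_cast; ring
    have a2 : c + ((s + 1 + m : ℕ) : ℝ) - ((s + 1 : ℕ) : ℝ) = c + m := by push_cast; ring
    have a3 : ((s + 1 + m : ℕ) : ℝ) - ((s + 1 : ℕ) : ℝ) + 1 = m + 1 := by push_cast; ring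
    rw [a1, a2, a3] at h
    exact_mod_cast h
  calc _ ≤ ((s + 1 + m).choose (s + 1) : ℝ) * (betaMoment c d (m + 1) s *
        ((s + 1) / (((s + 1 + m : ℕ) : ℝ) ^ u * (m + 1)))) := by gcongr
    _ = (((s + 1 + m).choose (s + 1) : ℝ) * (s + 1)) * (betaMoment c d (m + 1) s /
        (((s + 1 + m : ℕ) : ℝ) ^ u * (m + 1))) := by ring
    _ = _ := by rw [hch]; field_simp

lemma sizePrior_le (hc : 0 < c) (hd : 0 < d)
    (hβ : ∀ j ∈ Finset.Icc 1 G, (d + j - 1) / (c + G - j) ≤ j / ((G : ℝ) ^ u * (G - j + 1)))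
    {s : ℕ} (hs : s ≤ G) :
    sizePrior c d G s ≤ ((G : ℝ) ^ (-u)) ^ s * sizePrior c d G 0 := by
  induction s with
  | zero => simp
  | succ s ih =>
    refine (sizePrior_succ_le hc hd hβ (by omega)).trans ?_
    rw [pow_succ', mul_assoc]
    exact mul_le_mul_of_nonneg_left (ih (by omega)) (by positivity)

lemma sizePrior_zero_le_one (hc : 0 < c) (hd : 0 < d) : sizePrior c d G 0 ≤ 1 := by
  rw [← sum_sizePrior hc hd G]
  exact Finset.single_le_sum (f := fun s => sizePrior c d G s)
    (fun s _ => sizePrior_nonneg hc hd G s) (by simp)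

/-- The `G + 1` weights sum to one and the weight of the empty model is the largest, so it is at
least their average. -/
lemma one_div_le_sizePrior_zero (hc : 0 < c) (hd : 0 < d) (hu : 0 < u) (hG : 0 < G)
    (hβ : ∀ j ∈ Finset.Icc 1 G, (d + j - 1) / (c + G - j) ≤ j / ((G : ℝ) ^ u * (G - j + 1))) :
    1 / ((G : ℝ) + 1) ≤ sizePrior c d G 0 := by
  have hG' : (1 : ℝ) ≤ G := by exact_mod_cast hG
  have h1 : (G : ℝ) ^ (-u) ≤ 1 := Real.rpow_le_one_of_one_le_of_nonpos hG' (by linarith)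
  have h : (1 : ℝ) ≤ ∑ s ∈ Finset.range (G + 1), sizePrior c d G 0 := by
    rw [← sum_sizePrior hc hd G]
    refine Finset.sum_le_sum fun s hs => (sizePrior_le hc hd hβ ?_).trans ?_
    · simp at hs; omega
    · exact mul_le_of_le_one_left (sizePrior_nonneg hc hd G 0) (pow_le_one₀ (by positivity) h1)
  rw [Finset.sum_const, Finset.card_range, nsmul_eq_mul] at h
  rw [div_le_iff₀ (by positivity)]
  push_cast at h
  linarith

/-- Activating one more group multiplies the moment by `(d + s) / (c + m)`, which is at least `d /
(G + c)`. -/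
lemma betaMoment_ge (hc : 0 < c) (hd : 0 < d) (hu : 0 < u) (hG : 0 < G)
    (hβ : ∀ j ∈ Finset.Icc 1 G, (d + j - 1) / (c + G - j) ≤ j / ((G : ℝ) ^ u * (G - j + 1)))
    {s : ℕ} (hs : s ≤ G) :
    (d / (G + c)) ^ s * (1 / ((G : ℝ) + 1)) ≤ betaMoment c d (G - s) s := by
  induction s with
  | zero =>
    have := one_div_le_sizePrior_zero hc hd hu hG hβ
    simpa [sizePrior] using this
  | succ s ih =>
    obtain ⟨m, rfl⟩ : ∃ m, G = s + 1 + m := ⟨G - (s + 1), by omega⟩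
    have e1 : s + 1 + m - (s + 1) = m := by omega
    have e2 : s + 1 + m - s = m + 1 := by omega
    have ih' := ih (by omega)
    rw [e2] at ih'
    rw [e1, betaMoment_succ hc hd, pow_succ, mul_right_comm]
    refine mul_le_mul ih' ?_ (by positivity) (betaMoment_pos hc hd _ _).le
    have hs0 : (0 : ℝ) ≤ s := Nat.cast_nonneg s
    refine div_le_div₀ (by positivity) (by linarith) (by positivity) ?_
    push_cast; linarith

end Decay

/-! ### Prior mass of models with many active groups. -/

section Sparsity

variable {G : ℕ} {g : Fin G → ℕ}

/-- A union bound over the possible active sets, each of which corresponds to a box for the product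
prior. -/
lemma coefPrior_lt_numActive_le (hg : ∀ j, 0 < g j) {lam : Fin G → ℝ} (hl : ∀ j, 0 < lam j)
    {v p : ℝ} (hv : 0 < v) (hp : p ∈ Set.Icc (0 : ℝ) 1) (k : ℝ) :
    coefPrior g lam v p {θ | k < (numActive θ : ℝ)} ≤
      ∑ s ∈ Finset.range (G + 1) with k < ((s : ℕ) : ℝ), (G.choose s : ℝ≥0∞) *
        ENNReal.ofReal (p ^ (G - s) * (1 - p) ^ s) := by
  classical
  have := fun j => isProbabilityMeasure_groupPrior (hg j) (hl j) hv hp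
  have hp1 : 0 ≤ 1 - p := by linarith [hp.2]
  set R : Finset (Fin G) → Set (Coef g) := fun S =>
    Set.univ.pi fun j => if j ∈ S then {0}ᶜ else {0} with hR
  have hmeas : ∀ S, coefPrior g lam v p (R S) ≤
      ENNReal.ofReal (p ^ (G - S.card) * (1 - p) ^ S.card) := by
    intro S
    rw [hR, coefPrior, Measure.pi_pi]
    calc _ ≤ ∏ j, if j ∈ S then ENNReal.ofReal (1 - p) else ENNReal.ofReal p := by
          refine Finset.prod_le_prod' fun j _ => ?_
          split_ifs
          · exact groupPrior_compl_zero (hg j) (hl j) hv p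
          · exact (groupPrior_zero (hg j) _ _ _).le
      _ = _ := by
          rw [Finset.prod_ite, Finset.prod_const, Finset.prod_const, mul_comm,
            ← ENNReal.ofReal_pow hp1, ← ENNReal.ofReal_pow hp.1,
            ← ENNReal.ofReal_mul (pow_nonneg hp.1 _), Finset.filter_not]
          simp [Finset.card_sdiff]
  have hsub : {θ : Coef g | k < (numActive θ : ℝ)} ⊆
      ⋃ S ∈ (Finset.univ : Finset (Finset (Fin G))).filter (fun S => k < (S.card : ℝ)), R S := by
    intro θ hθ
    simp only [Set.mem_iUnion]
    refine ⟨Finset.univ.filter (fun j => θ j ≠ 0), ?_, ?_⟩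
    · simp only [Finset.mem_filter, Finset.mem_univ, true_and]
      simpa [numActive] using hθ
    · simp only [hR, Set.mem_pi, Set.mem_univ, forall_true_left]
      intro j
      by_cases h : θ j = 0 <;> simp [h]
  refine (measure_mono hsub).trans ((measure_biUnion_finset_le _ _).trans ?_)
  refine (Finset.sum_le_sum fun S _ => hmeas S).trans ?_
  rw [Finset.sum_filter, Finset.sum_filter]
  have := Finset.sum_powerset_apply_card (x := (Finset.univ : Finset (Fin G)))
    (fun s => if k < ((s : ℕ) : ℝ) then ENNReal.ofReal (p ^ (G - s) * (1 - p) ^ s) else 0)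
  rw [Finset.powerset_univ, Finset.card_univ, Fintype.card_fin] at this
  rw [this]
  refine Finset.sum_le_sum fun s _ => ?_
  split_ifs <;> simp

lemma ae_gammaMeasure_pos (a b : ℝ) : ∀ᵐ x ∂(gammaMeasure a b), 0 < x := by
  rw [gammaMeasure, ae_withDensity_iff (by unfold gammaPDF; fun_prop)]
  have h0 : ∀ᵐ x : ℝ, x ≠ 0 := by
    simp [ae_iff]
  refine h0.mono fun x hx hp => ?_
  by_contra hc
  exact hp (gammaPDF_of_neg (lt_of_le_of_ne (not_lt.mp hc) hx))

lemma ae_invGammaMeasure_pos (a b : ℝ) : ∀ᵐ v ∂(invGammaMeasure a b), 0 < v := by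
  rw [invGammaMeasure, ae_map_iff (by fun_prop) measurableSet_Ioi]
  exact (ae_gammaMeasure_pos a b).mono fun x hx => inv_pos.mpr hx

lemma isProbabilityMeasure_invGammaMeasure {a b : ℝ} (ha : 0 < a) (hb : 0 < b) :
    IsProbabilityMeasure (invGammaMeasure a b) := by
  have := isProbabilityMeasure_gammaMeasure ha hb
  exact Measure.isProbabilityMeasure_map (by fun_prop)

/-- Integrating out `p` gives a tail of the model-size prior. Each of the at most `G + 1` terms is
bounded through the geometric decay; the crude factor `G + 1` is harmless at the scale of the
evidence bound. -/
lemma prior_lt_numActive_le (hg : ∀ j, 0 < g j) {lam : Fin G → ℝ} (hl : ∀ j, 0 < lam j)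
    {c d u a b k : ℝ} (hc : 0 < c) (hd : 0 < d) (hu : 0 < u) (ha : 0 < a) (hb : 0 < b)
    (hG : 0 < G)
    (hβ : ∀ j ∈ Finset.Icc 1 G, (d + j - 1) / (c + G - j) ≤ j / ((G : ℝ) ^ u * (G - j + 1))) :
    ∫⁻ p, ∫⁻ v, coefPrior g lam v p {θ | k < (numActive θ : ℝ)} ∂(invGammaMeasure a b)
      ∂(betaMeasure c d) ≤ ENNReal.ofReal ((G + 1) * (G : ℝ) ^ (-(u * k))) := by
  have := isProbabilityMeasure_invGammaMeasure ha hb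
  have hG' : (1 : ℝ) ≤ G := by exact_mod_cast hG
  calc _ ≤ ∫⁻ p, ∑ s ∈ Finset.range (G + 1) with k < ((s : ℕ) : ℝ), (G.choose s : ℝ≥0∞) *
        ENNReal.ofReal (p ^ (G - s) * (1 - p) ^ s) ∂(betaMeasure c d) := by
        refine lintegral_mono_ae ((ae_betaMeasure_mem c d).mono fun p hp => ?_)
        refine (lintegral_mono_ae ((ae_invGammaMeasure_pos a b).mono fun v hv =>
          coefPrior_lt_numActive_le hg hl hv ⟨hp.1.le, hp.2.le⟩ k)).trans ?_
        simp
    _ = ∑ s ∈ Finset.range (G + 1) with k < ((s : ℕ) : ℝ),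
        ENNReal.ofReal (sizePrior c d G s) := by
        rw [lintegral_finsetSum _ (fun s _ => by fun_prop)]
        refine Finset.sum_congr rfl fun s _ => ?_
        rw [lintegral_const_mul _ (by fun_prop), lintegral_betaMeasure_pow hc hd, sizePrior,
          ENNReal.ofReal_mul (by positivity), ENNReal.ofReal_natCast]
    _ ≤ ∑ s ∈ Finset.range (G + 1) with k < ((s : ℕ) : ℝ),
        ENNReal.ofReal ((G : ℝ) ^ (-(u * k))) := by
        refine Finset.sum_le_sum fun s hs => ENNReal.ofReal_le_ofReal ?_
        simp only [Finset.mem_filter, Finset.mem_range] at hs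
        refine (sizePrior_le hc hd hβ (by omega)).trans ?_
        refine (mul_le_of_le_one_right (by positivity) (sizePrior_zero_le_one hc hd)).trans ?_
        rw [← Real.rpow_natCast, ← Real.rpow_mul (by positivity)]
        refine Real.rpow_le_rpow_of_exponent_le hG' ?_
        nlinarith [hs.2]
    _ ≤ ∑ s ∈ Finset.range (G + 1), ENNReal.ofReal ((G : ℝ) ^ (-(u * k))) :=
        Finset.sum_le_sum_of_subset (Finset.filter_subset _ _)
    _ = _ := by
        rw [Finset.sum_const, Finset.card_range, nsmul_eq_mul, ENNReal.ofReal_mul (by positivity)]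
        congr 1
        rw [← ENNReal.ofReal_natCast]; push_cast; rfl

end Sparsity

/-! ### Prior mass of the variance near the truth. -/

/-- The inverse gamma prior puts mass of order at least `1 / T` on `[w, w (1 + 1 / T)]`, uniformly
for `w` in a compact subset of `(0, ∞)`. -/
lemma exists_invGammaMeasure_Icc_ge {a b vlo vhi : ℝ} (ha : 0 < a) (hb : 0 < b) (hvlo : 0 < vlo)
    (hv : vlo ≤ vhi) :
    ∃ κ : ℝ, 0 < κ ∧ ∀ w ∈ Set.Icc vlo vhi, ∀ T : ℝ, 1 ≤ T →
      ENNReal.ofReal (κ / T) ≤ invGammaMeasure a b (Set.Icc w (w * (1 + 1 / T))) := by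
  have hvhi : 0 < vhi := hvlo.trans_le hv
  -- For `T ≥ 1` the variances stay in `[vlo, 2 vhi]`, so their inverses lie in this compact
  -- interval, on which the gamma density has a positive minimum.
  have hK : IsCompact (Set.Icc (1 / (2 * vhi)) (1 / vlo)) := isCompact_Icc
  have hpos : ∀ x ∈ Set.Icc (1 / (2 * vhi)) (1 / vlo), 0 < x := fun x hx =>
    lt_of_lt_of_le (by positivity) hx.1
  have hne : (Set.Icc (1 / (2 * vhi)) (1 / vlo)).Nonempty := by
    refine Set.nonempty_Icc.mpr (one_div_le_one_div_of_le hvlo (by linarith))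
  have hcont : ContinuousOn (fun x : ℝ => b ^ a / Real.Gamma a * x ^ (a - 1) * Real.exp (-(b * x)))
      (Set.Icc (1 / (2 * vhi)) (1 / vlo)) := by
    intro x hx
    refine ContinuousAt.continuousWithinAt ?_
    have := Real.continuousAt_rpow_const x (a - 1) (Or.inl (hpos x hx).ne')
    fun_prop
  obtain ⟨x₀, hx₀, hmin⟩ := hK.exists_isMinOn hne hcont
  set κ₀ := b ^ a / Real.Gamma a * x₀ ^ (a - 1) * Real.exp (-(b * x₀)) with hκ₀
  have hκ₀pos : 0 < κ₀ := by
    have := hpos x₀ hx₀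
    have := Real.Gamma_pos_of_pos ha
    positivity
  refine ⟨κ₀ / (2 * vhi), by positivity, fun w hw T hT => ?_⟩
  have hw0 : 0 < w := hvlo.trans_le hw.1
  have hT0 : 0 < T := by linarith
  have hT1 : 1 / T ≤ 1 := by rw [div_le_one hT0]; exact hT
  have hT2 : 0 < 1 / T := by positivity
  rw [invGammaMeasure, Measure.map_apply (by fun_prop) measurableSet_Icc]
  have hsub : Set.Icc (1 / (w * (1 + 1 / T))) (1 / w) ⊆
      (fun x : ℝ => x⁻¹) ⁻¹' Set.Icc w (w * (1 + 1 / T)) := by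
    intro x hx
    have hx0 : 0 < x := lt_of_lt_of_le (by positivity) hx.1
    constructor
    · rw [le_inv_comm₀ hw0 hx0, ← one_div]; exact hx.2
    · rw [inv_le_comm₀ hx0 (by positivity), ← one_div]; exact hx.1
  refine le_trans ?_ (measure_mono hsub)
  rw [gammaMeasure, withDensity_apply _ measurableSet_Icc]
  calc _ ≤ ∫⁻ x in Set.Icc (1 / (w * (1 + 1 / T))) (1 / w), ENNReal.ofReal κ₀ := by
        rw [setLIntegral_const, Real.volume_Icc, ← ENNReal.ofReal_mul hκ₀pos.le]
        apply ENNReal.ofReal_le_ofReal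
        have e : 1 / w - 1 / (w * (1 + 1 / T)) = 1 / (w * (T + 1)) := by
          field_simp; ring
        rw [e, div_div, div_eq_mul_one_div κ₀]
        have := hw.2
        refine mul_le_mul_of_nonneg_left ?_ hκ₀pos.le
        refine one_div_le_one_div_of_le (by positivity) ?_
        nlinarith
    _ ≤ _ := by
        refine setLIntegral_mono (by unfold gammaPDF; fun_prop) fun x hx => ?_
        have hxK : x ∈ Set.Icc (1 / (2 * vhi)) (1 / vlo) := by
          refine ⟨le_trans ?_ hx.1, hx.2.trans (one_div_le_one_div_of_le hvlo hw.1)⟩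
          refine one_div_le_one_div_of_le (by positivity) ?_
          nlinarith [hw.2]
        rw [gammaPDF_of_nonneg (hpos x hxK).le]
        exact ENNReal.ofReal_le_ofReal (hmin hxK)

/-! ### Bounds on the Gaussian log-likelihood. -/

section Likelihood

/-- The Gaussian log-likelihood with variance `v`, sample size `T` and residual sum of squares
`Q`. -/
noncomputable def gaussLogLik (T : ℕ) (v Q : ℝ) : ℝ :=
  -(T / 2 : ℝ) * Real.log (2 * Real.pi * v) - Q / (2 * v)

variable {T G : ℕ} {g : Fin G → ℕ}

/-- The residual sum of squares. -/
noncomputable def rss (Z : Design T g) (y : Fin T → ℝ) (θ : Coef g) : ℝ :=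
  ∑ t, (y t - Z.fit θ t) ^ 2

lemma likelihood_eq (Z : Design T g) (y : Fin T → ℝ) (θ : Coef g) {v : ℝ} (hv : 0 < v) :
    likelihood Z y θ v = ENNReal.ofReal (Real.exp (gaussLogLik T v (rss Z y θ))) := by
  have h : ∀ t, gaussianPDF (Z.fit θ t) v.toNNReal (y t) = ENNReal.ofReal (Real.exp
      (-(1 / 2 : ℝ) * Real.log (2 * Real.pi * v) - (y t - Z.fit θ t) ^ 2 / (2 * v))) := by
    intro t
    have h0 : 0 < 2 * Real.pi * v := by positivity
    rw [gaussianPDF, gaussianPDFReal, Real.coe_toNNReal _ hv.le, Real.exp_sub, neg_div,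
      Real.exp_neg, div_eq_mul_inv]
    congr 2
    rw [Real.sqrt_eq_rpow, Real.rpow_def_of_pos h0, ← Real.exp_neg]
    congr 1; ring
  rw [likelihood, Finset.prod_congr rfl fun t _ => h t,
    ← ENNReal.ofReal_prod_of_nonneg fun _ _ => (Real.exp_pos _).le, ← Real.exp_sum]
  congr 2
  rw [Finset.sum_sub_distrib, Finset.sum_const, Finset.card_univ, Fintype.card_fin, gaussLogLik,
    rss, Finset.sum_div, nsmul_eq_mul]
  ring

lemma likelihood_pos (Z : Design T g) (y : Fin T → ℝ) (θ : Coef g) {v : ℝ} (hv : 0 < v) :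
    0 < likelihood Z y θ v := by
  rw [likelihood_eq Z y θ hv]; simp [Real.exp_pos]

lemma likelihood_ne_top (Z : Design T g) (y : Fin T → ℝ) (θ : Coef g) {v : ℝ} (hv : 0 < v) :
    likelihood Z y θ v ≠ ∞ := by
  rw [likelihood_eq Z y θ hv]; simp

/-- With `s = √(1 + t)`, the bound `log s ≥ 1 - 1 / s` leaves a gap that factorises as a square
times a polynomial; `s ^ 2 ≥ 3 / 4` makes that polynomial nonnegative. -/
lemma sub_sq_le_log_one_add {t : ℝ} (ht : -(1 / 4) ≤ t) : t - t ^ 2 ≤ Real.log (1 + t) := by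
  obtain ⟨s, hs⟩ : ∃ s, s = √(1 + t) := ⟨_, rfl⟩
  have hs0 : 0 < s := by rw [hs]; exact Real.sqrt_pos.mpr (by linarith)
  have hs2 : s ^ 2 = 1 + t := by rw [hs]; exact Real.sq_sqrt (by linarith)
  have h1 := Real.one_sub_inv_le_log_of_pos hs0
  have h2 : Real.log (1 + t) = 2 * Real.log s := by
    rw [← hs2, Real.log_pow]; norm_num
  have h3 : 2 * (1 - s⁻¹) - (t - t ^ 2) = (s - 1) ^ 2 * (s ^ 3 + 2 * s ^ 2 - 2) / s := by
    rw [show t = s ^ 2 - 1 by linarith]; field_simp; ring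
  have h4 : 0 ≤ s ^ 3 + 2 * s ^ 2 - 2 := by
    have : 2 / 3 ≤ s := by nlinarith
    nlinarith
  have h5 : 0 ≤ (s - 1) ^ 2 * (s ^ 3 + 2 * s ^ 2 - 2) / s := by positivity
  linarith

/-- The likelihood is small, uniformly in the variance, when the fit is bad. -/
lemma gaussLogLik_le {v v₀ N Q m ε : ℝ} (hT : 0 < T) (hv : 0 < v) (hv₀ : 0 < v₀)
    (hN : |N / (T * v₀) - 1| ≤ ε) (hε : ε ≤ 1 / 4) (hm : 0 ≤ m) (hm' : m ≤ 1 / 4)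
    (hQ : N + T * v₀ * m ≤ Q) :
    gaussLogLik T v Q ≤ gaussLogLik T v₀ N - T / 2 * (m / 2 - 2 * ε ^ 2) := by
  have hT' : (0 : ℝ) < T := by exact_mod_cast hT
  obtain ⟨η, hη⟩ : ∃ η, η = N / (T * v₀) - 1 := ⟨_, rfl⟩
  have hNη : N = T * v₀ * (1 + η) := by rw [hη]; field_simp; ring
  rw [← hη] at hN
  have hη2 : η ^ 2 ≤ ε ^ 2 := sq_le_sq' (abs_le.mp hN).1 (abs_le.mp hN).2
  have hηl := (abs_le.mp hN).1
  have hηu := (abs_le.mp hN).2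
  set t := η + m with ht
  have ht0 : 0 < 1 + t := by linarith
  have hlog : t - t ^ 2 ≤ Real.log (1 + t) := sub_sq_le_log_one_add (by linarith)
  -- This inequality carries out the maximisation over `v`: equality holds at `v = v₀ (1 + t)`.
  have hx : Real.log (v₀ * (1 + t) / v) ≤ v₀ * (1 + t) / v - 1 :=
    Real.log_le_sub_one_of_pos (by positivity)
  have hQ' : T * v₀ * (1 + t) ≤ Q := by rw [hNη] at hQ; rw [ht]; linarith
  have hQv : T * (v₀ * (1 + t) / v) / 2 ≤ Q / (2 * v) := by
    rw [div_le_div_iff₀ (by positivity) (by positivity)]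
    field_simp
    linarith
  have hNv : N / (2 * v₀) = T * (1 + η) / 2 := by rw [hNη]; field_simp
  unfold gaussLogLik
  rw [hNv]
  have hp : (0 : ℝ) < 2 * Real.pi := by positivity
  rw [Real.log_mul hp.ne' hv.ne', Real.log_mul hp.ne' hv₀.ne']
  rw [Real.log_div (by positivity) hv.ne', Real.log_mul hv₀.ne' ht0.ne'] at hx
  -- The gain is `m - t ^ 2`; the part of `t ^ 2` due to `m` absorbs at most `m / 2`, and the noise
  -- part at most `2 ε ^ 2`.
  have h3 : t ^ 2 ≤ 2 * η ^ 2 + 2 * m ^ 2 := by nlinarith [sq_nonneg (η - m)]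
  have h4 : m ^ 2 ≤ m / 4 := by nlinarith
  nlinarith

/-- Inflating the variance by at most `1 + 1 / T` costs at most 1/2 in the normalising factor and
can only shrink the quadratic term. -/
lemma le_gaussLogLik {v v₀ N Q C : ℝ} (hT : 0 < T) (hv₀ : 0 < v₀) (hN : 0 ≤ N) (hC : 0 ≤ C)
    (hv : v ∈ Set.Icc v₀ (v₀ * (1 + 1 / T))) (hQ : Q ≤ N + v₀ * C) :
    gaussLogLik T v₀ N - (1 + C) / 2 ≤ gaussLogLik T v Q := by
  have hT' : (0 : ℝ) < T := by exact_mod_cast hT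
  have hv0 : 0 < v := hv₀.trans_le hv.1
  have hp : (0 : ℝ) < 2 * Real.pi := by positivity
  unfold gaussLogLik
  rw [Real.log_mul hp.ne' hv0.ne', Real.log_mul hp.ne' hv₀.ne']
  have h1 : Real.log v ≤ Real.log v₀ + 1 / T := by
    have := Real.log_le_log hv0 hv.2
    rw [Real.log_mul hv₀.ne' (by positivity)] at this
    have h2 := Real.log_le_sub_one_of_pos (show (0 : ℝ) < 1 + 1 / T by positivity)
    linarith
  have h2 : T / 2 * Real.log v ≤ T / 2 * Real.log v₀ + 1 / 2 := by
    have := mul_le_mul_of_nonneg_left h1 (by positivity : (0 : ℝ) ≤ T / 2)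
    have e : (T : ℝ) / 2 * (1 / T) = 1 / 2 := by field_simp
    linarith
  have h3 : Q / (2 * v) ≤ N / (2 * v₀) + C / 2 := by
    calc Q / (2 * v) ≤ (N + v₀ * C) / (2 * v) := by gcongr
      _ ≤ (N + v₀ * C) / (2 * v₀) := by
          have := hv.1
          gcongr
      _ = _ := by field_simp
  linarith

lemma measurable_likelihood (Z : Design T g) : Measurable fun q : ((Fin T → ℝ) × (ℝ × ℝ)) × Coef g =>
    likelihood Z q.1.1 q.2 q.1.2.2 := by
  unfold likelihood gaussianPDF gaussianPDFReal Design.fit Matrix.mulVec dotProduct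
  refine Finset.measurable_prod _ fun t _ => ENNReal.measurable_ofReal.comp ?_
  have hc : ∀ p : (j : Fin G) × Fin (g j),
      Measurable fun q : ((Fin T → ℝ) × (ℝ × ℝ)) × Coef g => q.2 p.1 p.2 := fun p => by fun_prop
  have hs : Measurable fun q : ((Fin T → ℝ) × (ℝ × ℝ)) × Coef g => ∑ p, Z t p * q.2 p.1 p.2 :=
    Finset.measurable_sum _ fun p _ => (hc p).const_mul _
  fun_prop

end Likelihood

/-! ### Expected likelihood ratios under the truth. -/

section Expectation

variable {T : ℕ}

instance isProbabilityMeasure_dataLaw {G : ℕ} {g : Fin G → ℕ} (Z : Design T g) (θ : Coef g)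
    (v : ℝ) : IsProbabilityMeasure (dataLaw Z θ v) := by
  unfold dataLaw; infer_instance

lemma measurable_likelihood_left {G : ℕ} {g : Fin G → ℕ} (Z : Design T g) (θ : Coef g) (v : ℝ) :
    Measurable fun y => likelihood Z y θ v := by
  unfold likelihood
  exact Finset.measurable_prod _ fun t _ =>
    (measurable_gaussianPDF _ _).comp (measurable_pi_apply t)

lemma measurable_likelihood_uncurry {G : ℕ} {g : Fin G → ℕ} (Z : Design T g) (v : ℝ) :
    Measurable fun z : (Fin T → ℝ) × Coef g => likelihood Z z.1 z.2 v := by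
  have h : Measurable fun z : (Fin T → ℝ) × Coef g => ((z.1, ((0 : ℝ), v)), z.2) :=
    (measurable_fst.prodMk measurable_const).prodMk measurable_snd
  have := (measurable_likelihood Z).comp h
  exact this

lemma lintegral_likelihood_ratio {G : ℕ} {g : Fin G → ℕ} (Z : Design T g) (θ θ₀ : Coef g)
    {v v₀ : ℝ} (hv : 0 < v) (hv₀ : 0 < v₀) :
    ∫⁻ y, likelihood Z y θ v / likelihood Z y θ₀ v₀ ∂(dataLaw Z θ₀ v₀) = 1 := by
  have hv' : v.toNNReal ≠ 0 := by simpa using hv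
  have hv₀' : v₀.toNNReal ≠ 0 := by simpa using hv₀
  have h : ∀ y, likelihood Z y θ v / likelihood Z y θ₀ v₀ = ∏ t,
      (gaussianPDF (Z.fit θ t) v.toNNReal (y t) / gaussianPDF (Z.fit θ₀ t) v₀.toNNReal (y t)) := by
    intro y
    simp only [likelihood, div_eq_mul_inv, Finset.prod_mul_distrib]
    congr 1
    exact ENNReal.prod_inv_distrib fun i _ j _ _ => Or.inr gaussianPDF_ne_top
  simp_rw [h]
  rw [dataLaw, lintegral_pi_prod _ (fun t x => gaussianPDF (Z.fit θ t) v.toNNReal x /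
    gaussianPDF (Z.fit θ₀ t) v₀.toNNReal x)
    (fun t => (measurable_gaussianPDF _ _).div (measurable_gaussianPDF _ _))]
  refine Finset.prod_eq_one fun t _ => ?_
  rw [gaussianReal_of_var_ne_zero _ hv₀', ← lintegral_gaussianPDF_eq_one (Z.fit θ t) hv']
  refine (lintegral_withDensity_eq_lintegral_mul _ (measurable_gaussianPDF _ _)
    ((measurable_gaussianPDF _ _).div (measurable_gaussianPDF _ _))).trans ?_
  refine lintegral_congr fun x => ?_
  rw [Pi.mul_apply]
  exact ENNReal.mul_div_cancel (gaussianPDF_pos _ hv₀' x).ne' gaussianPDF_ne_top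

variable (X : Setup T) {a b : ℝ}

/-- By Tonelli the data are integrated first; each likelihood ratio then contributes one, and only
the prior mass of `B` remains. -/
lemma lintegral_jointMass_div_le (ha : 0 < a) (hb : 0 < b) {B : Set (Coef X.g)}
    (hB : MeasurableSet B) (θ₀ : Coef X.g) {v₀ : ℝ} (hv₀ : 0 < v₀) :
    ∫⁻ y, X.jointMass a b y B / likelihood X.Z y θ₀ v₀ ∂(dataLaw X.Z θ₀ v₀) ≤
      ∫⁻ p, ∫⁻ v, coefPrior X.g X.lam v p B ∂(invGammaMeasure a b) ∂(betaMeasure X.c X.d) := by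
  have := isProbabilityMeasure_invGammaMeasure ha hb
  have := isProbabilityMeasureBeta X.c_pos X.d_pos
  have hprob := isProbabilityMeasure_coefPriorOr X.g_pos X.lam_pos
  -- Tonelli needs a kernel defined for all `(p, v)`; `coefPriorOr` differs from the prior only on a
  -- null set of hyper-parameters.
  let κ : Kernel (ℝ × ℝ) (Coef X.g) := ⟨coefPriorOr X.g X.lam,
    measurable_coefPriorOr X.g_pos X.lam_pos⟩
  have : IsMarkovKernel κ := ⟨hprob⟩
  have hae : ∀ {f g : ℝ → ℝ → ℝ≥0∞}, (∀ p ∈ Set.Ioo (0 : ℝ) 1, ∀ v > 0, f p v = g p v) →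
      ∫⁻ p, ∫⁻ v, f p v ∂(invGammaMeasure a b) ∂(betaMeasure X.c X.d) =
      ∫⁻ p, ∫⁻ v, g p v ∂(invGammaMeasure a b) ∂(betaMeasure X.c X.d) := fun h =>
    lintegral_congr_ae ((ae_betaMeasure_mem _ _).mono fun p hp =>
      lintegral_congr_ae ((ae_invGammaMeasure_pos a b).mono fun v hv => h p hp v hv))
  have hκ : ∀ p ∈ Set.Ioo (0 : ℝ) 1, ∀ v > 0, κ (p, v) = coefPrior X.g X.lam v p := by
    intro p hp v hv
    change coefPriorOr X.g X.lam (p, v) = _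
    rw [coefPriorOr, if_pos ⟨⟨hp.1.le, hp.2.le⟩, hv⟩]
  obtain ⟨r, hr⟩ : ∃ r : (Fin T → ℝ) → ℝ≥0∞, r = fun y => (likelihood X.Z y θ₀ v₀)⁻¹ := ⟨_, rfl⟩
  have hrm : Measurable r := hr ▸ (measurable_likelihood_left X.Z θ₀ v₀).inv
  have hrt : ∀ y, r y ≠ ∞ := fun y => by
    simp only [hr, ne_eq, ENNReal.inv_eq_top]
    exact (likelihood_pos X.Z y θ₀ hv₀).ne'
  set Φ : ((Fin T → ℝ) × (ℝ × ℝ)) → ℝ≥0∞ := fun q =>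
    ∫⁻ θ in B, likelihood X.Z q.1 θ q.2.2 * r q.1 ∂(κ q.2) with hΦ
  have hF : Measurable fun q : ((Fin T → ℝ) × (ℝ × ℝ)) × Coef X.g =>
      likelihood X.Z q.1.1 q.2 q.1.2.2 * r q.1.1 := (measurable_likelihood X.Z).mul (by fun_prop)
  have hΦm : Measurable Φ := by
    have := Measurable.lintegral_kernel_prod_right'
      (κ := (κ.comap (Prod.snd : (Fin T → ℝ) × (ℝ × ℝ) → ℝ × ℝ) measurable_snd).restrict hB)
      (f := fun q : ((Fin T → ℝ) × (ℝ × ℝ)) × Coef X.g =>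
        likelihood X.Z q.1.1 q.2 q.1.2.2 * r q.1.1) hF
    simpa [hΦ, Kernel.restrict_apply, Kernel.comap_apply] using this
  have h1 : ∀ y, X.jointMass a b y B / likelihood X.Z y θ₀ v₀ =
      ∫⁻ q, Φ (y, q) ∂((betaMeasure X.c X.d).prod (invGammaMeasure a b)) := by
    intro y
    have hy : (likelihood X.Z y θ₀ v₀)⁻¹ = r y := by rw [hr]
    rw [lintegral_prod (fun q => Φ (y, q)) (hΦm.comp measurable_prodMk_left).aemeasurable,
      Setup.jointMass, div_eq_mul_inv, hy, ← lintegral_mul_const' _ _ (hrt y)]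
    simp_rw [← lintegral_mul_const' (r y) _ (hrt y)]
    refine hae fun p hp v hv => ?_
    simp only [hΦ, hκ p hp v hv]
  simp_rw [h1]
  rw [lintegral_lintegral_swap hΦm.aemeasurable]
  have h2 : ∀ q : ℝ × ℝ, 0 < q.2 → ∫⁻ y, Φ (y, q) ∂(dataLaw X.Z θ₀ v₀) = κ q B := by
    intro q hq
    have hm : Measurable (Function.uncurry fun (y : Fin T → ℝ) (θ : Coef X.g) =>
        likelihood X.Z y θ q.2 * r y) :=
      (measurable_likelihood_uncurry X.Z q.2).mul (hrm.comp measurable_fst)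
    simp only [hΦ]
    rw [lintegral_lintegral_swap hm.aemeasurable]
    have : ∀ θ, ∫⁻ y, likelihood X.Z y θ q.2 * r y ∂(dataLaw X.Z θ₀ v₀) = 1 := fun θ => by
      rw [← lintegral_likelihood_ratio X.Z θ θ₀ hq hv₀, hr]
      rfl
    simp_rw [this]
    simp
  have h3 : Measurable fun q => ∫⁻ y, Φ (y, q) ∂(dataLaw X.Z θ₀ v₀) :=
    Measurable.lintegral_prod_left' hΦm
  rw [lintegral_prod _ h3.aemeasurable]
  refine le_of_eq (hae fun p hp v hv => ?_)
  rw [h2 (p, v) hv, hκ p hp v hv]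

end Expectation

/-! ### Fitted values, group spans and the sparse singular value. -/

section Geometry

variable {T G : ℕ} {g : Fin G → ℕ}

lemma numActive_sub_le (θ θ' : Coef g) : numActive (θ - θ') ≤ numActive θ + numActive θ' := by
  classical
  unfold numActive
  rw [← Finset.card_union_add_card_inter]
  refine le_trans (Finset.card_le_card fun j => ?_) (Nat.le_add_right _ _)
  simp only [Finset.mem_filter, Finset.mem_univ, true_and, Finset.mem_union, Pi.sub_apply]
  intro h
  by_contra hc
  push Not at hc
  exact h (by rw [hc.1, hc.2, sub_zero])

lemma Design.fit_sub (Z : Design T g) (θ θ' : Coef g) : Z.fit (θ - θ') = Z.fit θ - Z.fit θ' := by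
  unfold Design.fit
  rw [← Matrix.mulVec_sub]
  rfl

lemma norm_fit_le (Z : Design T g) (h : Coef g) :
    ‖(WithLp.toLp 2 (Z.fit h) : EuclideanSpace ℝ (Fin T))‖ ≤ Z.groupNorm * ∑ j, ‖h j‖ := by
  have e : (WithLp.toLp 2 (Z.fit h) : EuclideanSpace ℝ (Fin T)) =
      ∑ j, Matrix.toEuclideanLin (Z.block j) (h j) := by
    ext t
    simp only [WithLp.ofLp_sum, Finset.sum_apply, Design.fit, Matrix.mulVec, dotProduct,
      Fintype.sum_sigma]
    rfl
  rw [e, Finset.mul_sum]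
  refine (norm_sum_le _ _).trans (Finset.sum_le_sum fun j _ => ?_)
  refine ((LinearMap.toContinuousLinearMap (Matrix.toEuclideanLin (Z.block j))).le_opNorm
    (h j)).trans ?_
  refine mul_le_mul_of_nonneg_right ?_ (norm_nonneg _)
  exact le_ciSup (f := fun j => matSpectralNorm (Z.block j)) (Set.finite_range _).bddAbove j

/-- The span of the columns of the design in the groups belonging to `S`. -/
noncomputable def groupSpan (Z : Design T g) (S : Finset (Fin G)) :
    Submodule ℝ (EuclideanSpace ℝ (Fin T)) :=
  Submodule.span ℝ (((S.sigma fun _ => Finset.univ).image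
    fun p : (j : Fin G) × Fin (g j) => (WithLp.toLp 2 (Z.col p) : EuclideanSpace ℝ (Fin T))) :
      Set (EuclideanSpace ℝ (Fin T)))

lemma finrank_groupSpan_le (Z : Design T g) (S : Finset (Fin G)) :
    Module.finrank ℝ (groupSpan Z S) ≤ ∑ j ∈ S, g j := by
  refine (finrank_span_finset_le_card _).trans (Finset.card_image_le.trans ?_)
  simp [Finset.card_sigma]

lemma fit_mem_groupSpan (Z : Design T g) {S : Finset (Fin G)} {h : Coef g}
    (hS : ∀ j ∉ S, h j = 0) : WithLp.toLp 2 (Z.fit h) ∈ groupSpan Z S := by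
  have e : (WithLp.toLp 2 (Z.fit h) : EuclideanSpace ℝ (Fin T)) =
      ∑ p : (j : Fin G) × Fin (g j), h p.1 p.2 • WithLp.toLp 2 (Z.col p) := by
    ext t
    simp only [WithLp.ofLp_sum, Finset.sum_apply, Design.fit, Matrix.mulVec, dotProduct,
      WithLp.ofLp_smul, Pi.smul_apply, smul_eq_mul, Matrix.col_apply]
    exact Finset.sum_congr rfl fun p _ => mul_comm _ _
  rw [e]
  refine Submodule.sum_mem _ fun p _ => ?_
  by_cases hp : p.1 ∈ S
  · refine Submodule.smul_mem _ _ (Submodule.subset_span ?_)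
    simp only [Finset.coe_image, Set.mem_image, Finset.mem_coe, Finset.mem_sigma, Finset.mem_univ,
      and_true]
    exact ⟨p, hp, rfl⟩
  · rw [hS p.1 hp]
    simp

/-- A single admissible vector bounds the infimum. This excludes the value `∞` of an empty infimum,
under which the radius would collapse to 0. -/
lemma phi_ne_top (Z : Design T g) (hZ : 0 < Z.groupNorm) {s : ℝ} {θ : Coef g} (hθ : θ ≠ 0)
    (hs : (numActive θ : ℝ) ≤ s) : Z.phi s ≠ ∞ := by
  have hn : 0 < normSq θ := by
    obtain ⟨j, hj⟩ := Function.ne_iff.mp hθ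
    exact Finset.sum_pos' (fun _ _ => by positivity)
      ⟨j, Finset.mem_univ _, by have := norm_pos_iff.mpr hj; positivity⟩
  refine ne_top_of_le_ne_top ?_ (iInf_le_of_le θ (iInf_le_of_le hθ (iInf_le_of_le hs le_rfl)))
  refine ENNReal.div_ne_top ENNReal.ofReal_ne_top ?_
  simp only [ne_eq, ENNReal.ofReal_eq_zero, not_le]
  positivity

/-- A bound from below on the estimation error entails a bound on the prediction error. -/
lemma le_sum_fit_sq_of_le_normSq (Z : Design T g) (hZ : 0 < Z.groupNorm) {s A : ℝ} (hA : 0 < A)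
    {h : Coef g} (hs : (numActive h : ℝ) ≤ s) (hφ : Z.phi s ≠ ∞)
    (hr : ENNReal.ofReal A / (Z.phi s * ENNReal.ofReal (Z.groupNorm ^ 2)) ≤
      ENNReal.ofReal (normSq h)) :
    A ≤ ∑ t, Z.fit h t ^ 2 := by
  -- Clearing the denominator remains valid when `φ̃ = 0`: the radius is then `∞`, while the squared
  -- distance is finite.
  rw [ENNReal.div_le_iff_le_mul (Or.inr ENNReal.ofReal_ne_top)
    (Or.inl (ENNReal.mul_ne_top hφ ENNReal.ofReal_ne_top))] at hr
  have hS : 0 ≤ ∑ t, Z.fit h t ^ 2 := Finset.sum_nonneg fun _ _ => sq_nonneg _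
  rcases eq_or_ne h 0 with rfl | h0
  · simp [normSq] at hr
    linarith
  · have hn : 0 < normSq h := by
      obtain ⟨j, hj⟩ := Function.ne_iff.mp h0
      exact Finset.sum_pos' (fun _ _ => by positivity)
        ⟨j, Finset.mem_univ _, by have := norm_pos_iff.mpr hj; positivity⟩
    have hle : Z.phi s ≤ ENNReal.ofReal (∑ t, Z.fit h t ^ 2) /
        ENNReal.ofReal (Z.groupNorm ^ 2 * normSq h) :=
      iInf_le_of_le h (iInf_le_of_le h0 (iInf_le_of_le hs le_rfl))
    have hgn : 0 < Z.groupNorm ^ 2 * normSq h := by positivity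
    rw [← ENNReal.ofReal_div_of_pos hgn] at hle
    have := hr.trans (by gcongr : _ ≤ ENNReal.ofReal (normSq h) * (ENNReal.ofReal
      ((∑ t, Z.fit h t ^ 2) / (Z.groupNorm ^ 2 * normSq h)) * ENNReal.ofReal (Z.groupNorm ^ 2)))
    rw [← ENNReal.ofReal_mul (by positivity), ← ENNReal.ofReal_mul hn.le,
      ENNReal.ofReal_le_ofReal_iff (by positivity)] at this
    refine this.trans (le_of_eq ?_)
    field_simp

lemma rss_eq (Z : Design T g) (y : Fin T → ℝ) (θ θ₀ : Coef g) :
    rss Z y θ = rss Z y θ₀ - 2 * ∑ t, (y t - Z.fit θ₀ t) * Z.fit (θ - θ₀) t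
      + ∑ t, Z.fit (θ - θ₀) t ^ 2 := by
  rw [Z.fit_sub]
  unfold rss
  rw [Finset.mul_sum, ← Finset.sum_sub_distrib, ← Finset.sum_add_distrib]
  refine Finset.sum_congr rfl fun t _ => ?_
  simp only [Pi.sub_apply]
  ring

end Geometry

/-! ### Working assumptions at a fixed sample size, and the slab cost. -/

/-- Consequences, for a single large sample size, of the assumptions on the design and on the
prior. -/
structure Regime {T : ℕ} (X : Setup T) (cg Chi u dlo cπ : ℝ) : Prop where
  T_ge : 3 ≤ T
  one_le_logT : 1 ≤ Real.log T
  G_ge : 2 ≤ X.G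
  one_le_logG : 1 ≤ Real.log X.G
  logT_le : Real.log T ≤ cg * Real.log X.G
  s0_pos : 1 ≤ X.s0
  s0_le_T : (X.s0 : ℝ) ≤ T
  s0_le_G : X.s0 ≤ X.G
  groupNorm_pos : 0 < X.Z.groupNorm
  size_mul_le : ∀ j, (X.g j : ℝ) * Real.log T ≤ cg * Real.log X.G
  size_le : ∀ j, X.g j ≤ T
  le_lam : ∀ j, X.Z.groupNorm / √(T : ℝ) ≤ X.lam j
  lam_le : ∀ j, X.lam j ≤ Chi * √(Real.log T)
  lam_le' : ∀ j, X.lam j ≤ Chi * (√(Real.log X.G) * X.Z.groupNorm)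
  beta_cond : ∀ j ∈ Finset.Icc 1 X.G,
    (X.d + j - 1) / (X.c + X.G - j) ≤ j / ((X.G : ℝ) ^ u * (X.G - j + 1))
  le_d : dlo ≤ X.d
  log_add_le : Real.log (X.G + X.c) ≤ cπ * Real.log X.G
  eps_pos : 0 < X.eps
  eps_le : X.eps ≤ 1 / 4
  le_eps : X.s0 * Real.log X.G ≤ T * X.eps ^ 2
  logT_le_eps : Real.log T ≤ T * X.eps ^ 2
  s0_le_sTilde : (X.s0 : ℝ) ≤ X.sTilde
  sTilde_le : X.sTilde ≤ (1 + cg) * X.s0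

/-- The constant in the lower bound of the slab mass near a true group. -/
noncomputable def slabConst (vlo vhi cg cθ Chi : ℝ) : ℝ :=
  4 * cg + cg * |Real.log √(2 * vhi)| + (Chi * (√cg * cθ) + Chi) / √vlo

/-- Every loss is of order `L` because `n log T ≤ cg L`. The factorial costs one `n log T` and `lam
r ≥ T ^ (-3)` costs three, whence `4 cg`. Of the two upper bounds on `lam`, the one by `√(log T)`
controls the term in `nx`, and the one containing `K` cancels the `K` in the radius. -/
lemma exp_neg_slabConst_le {vlo vhi cg cθ Chi : ℝ} (hvlo : 0 < vlo) (hcg : 0 < cg) (hcθ : 0 < cθ)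
    (hChi : 0 < Chi) {n T : ℕ} {L lam v K nx : ℝ} (hT : 3 ≤ T) (hl : 1 ≤ Real.log T) (hL : 1 ≤ L)
    (hnl : n * Real.log T ≤ cg * L) (hnT : n ≤ T) (hK : 0 < K) (hlam : K / √(T : ℝ) ≤ lam)
    (hlam1 : lam ≤ Chi * √(Real.log T)) (hlam2 : lam ≤ Chi * (√L * K)) (hn : 0 < n)
    (hv : v ∈ Set.Icc vlo (2 * vhi)) (hnx0 : 0 ≤ nx) (hnx : nx ≤ √n * (cθ * √L)) :
    Real.exp (-(slabConst vlo vhi cg cθ Chi * L)) ≤ (lam / √v * (1 / (T ^ 2 * K))) ^ n / n.factorial *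
      Real.exp (-(lam / √v) * (nx + 1 / (T ^ 2 * K))) := by
  have hT' : (3 : ℝ) ≤ T := by exact_mod_cast hT
  have hT0 : (0 : ℝ) < T := by linarith
  set l := Real.log T with hldef
  set r := 1 / ((T : ℝ) ^ 2 * K) with hr
  have hr0 : 0 < r := by positivity
  have hlam0 : 0 < lam := lt_of_lt_of_le (by positivity) hlam
  have hv0 : 0 < v := hvlo.trans_le hv.1
  have hsv : 0 < √v := Real.sqrt_pos.mpr hv0
  have hsvlo : 0 < √vlo := Real.sqrt_pos.mpr hvlo
  have hsv1 : √vlo ≤ √v := Real.sqrt_le_sqrt hv.1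
  have hn0 : (0 : ℝ) < n := by exact_mod_cast hn
  have hf : (0 : ℝ) < n.factorial := by exact_mod_cast n.factorial_pos
  have hlogfac : Real.log n.factorial ≤ n * l := by
    have h1 : (n.factorial : ℝ) ≤ (T : ℝ) ^ n := by
      exact_mod_cast (Nat.factorial_le_pow n).trans (Nat.pow_le_pow_left hnT n)
    rw [hldef, ← Real.log_pow]
    exact Real.log_le_log hf h1
  have hlr : -(3 * l) ≤ Real.log (lam * r) := by
    have h1 : 1 / (T : ℝ) ^ 3 ≤ lam * r := by
      have hsq : √(T : ℝ) ≤ T := by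
        rw [Real.sqrt_le_left hT0.le]; nlinarith
      calc 1 / (T : ℝ) ^ 3 = K / T * r := by rw [hr]; field_simp
        _ ≤ K / √(T : ℝ) * r := by gcongr
        _ ≤ _ := by gcongr
    have h2 := Real.log_le_log (by positivity) h1
    rw [one_div, Real.log_inv, Real.log_pow] at h2
    push_cast at h2
    exact h2
  have hlsv : Real.log √v ≤ |Real.log √(2 * vhi)| :=
    (Real.log_le_log hsv (Real.sqrt_le_sqrt hv.2)).trans (le_abs_self _)
  have hnL : (n : ℝ) ≤ cg * L := by nlinarith
  have hlog : Real.log (lam / √v * r) = Real.log (lam * r) - Real.log √v := by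
    rw [div_mul_eq_mul_div, Real.log_div (by positivity) hsv.ne']
  have h1 : -(3 * (cg * L)) - cg * L * |Real.log √(2 * vhi)| ≤ n * Real.log (lam / √v * r) := by
    rw [hlog]
    have a1 : (n : ℝ) * Real.log √v ≤ cg * L * |Real.log √(2 * vhi)| :=
      (mul_le_mul_of_nonneg_left hlsv hn0.le).trans
        (mul_le_mul_of_nonneg_right hnL (abs_nonneg _))
    have a2 := mul_le_mul_of_nonneg_left hlr hn0.le
    nlinarith
  have h2 : lam / √v * nx ≤ Chi * (√cg * cθ) / √vlo * L := by
    have hs : √l * √n ≤ √cg * √L := by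
      rw [← Real.sqrt_mul (by linarith), ← Real.sqrt_mul hcg.le]
      exact Real.sqrt_le_sqrt (by linarith)
    have hLs : √L * √L = L := Real.mul_self_sqrt (by linarith)
    calc lam / √v * nx ≤ (Chi * √l) / √vlo * (√n * (cθ * √L)) := by gcongr
      _ = Chi * cθ / √vlo * √L * (√l * √n) := by ring
      _ ≤ Chi * cθ / √vlo * √L * (√cg * √L) := by gcongr
      _ = Chi * (√cg * cθ) / √vlo * (√L * √L) := by ring
      _ = _ := by rw [hLs]
  have h3 : lam / √v * r ≤ Chi / √vlo * L := by
    have hLs : √L ≤ L := by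
      rw [Real.sqrt_le_left (by linarith)]; nlinarith
    have hT2 : 1 / (T : ℝ) ^ 2 ≤ 1 := by
      rw [div_le_one (by positivity)]; nlinarith
    calc lam / √v * r ≤ (Chi * (L * K)) / √vlo * r := by
          refine mul_le_mul_of_nonneg_right ?_ hr0.le
          refine div_le_div₀ (by positivity) (hlam2.trans ?_) hsvlo hsv1
          gcongr
      _ = Chi / √vlo * L * (1 / (T : ℝ) ^ 2) := by rw [hr]; field_simp
      _ ≤ Chi / √vlo * L * 1 := by gcongr
      _ = _ := by ring
  rw [← Real.exp_log (show 0 < (lam / √v * r) ^ n / n.factorial by positivity), ← Real.exp_add,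
    Real.exp_le_exp, Real.log_div (by positivity) hf.ne', Real.log_pow]
  have e : slabConst vlo vhi cg cθ Chi * L = 4 * (cg * L) + cg * L * |Real.log √(2 * vhi)|
      + Chi * (√cg * cθ) / √vlo * L + Chi / √vlo * L := by unfold slabConst; ring
  rw [e]
  nlinarith

/-! ### Lower bound for the evidence. -/

section Evidence

variable {T : ℕ} {X : Setup T} {vlo vhi cg cθ Chi u dlo cπ a b : ℝ}

lemma norm_le_of_mem_trueCoef {θ₀ : Coef X.g} (hθ₀ : θ₀ ∈ X.trueCoef cθ) (hcθ : 0 < cθ)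
    (j : Fin X.G) : ‖θ₀ j‖ ≤ √(X.g j) * (cθ * √(Real.log X.G)) := by
  have h0 : 0 ≤ cθ * √(Real.log X.G) := by positivity
  rw [EuclideanSpace.norm_eq]
  calc _ ≤ √(∑ i : Fin (X.g j), (cθ * √(Real.log X.G)) ^ 2) := by
        refine Real.sqrt_le_sqrt (Finset.sum_le_sum fun i _ => ?_)
        have := hθ₀.1 j i
        rw [Real.norm_eq_abs]
        gcongr
    _ = _ := by
        rw [Finset.sum_const, Finset.card_univ, Fintype.card_fin, nsmul_eq_mul,
          Real.sqrt_mul (by positivity), Real.sqrt_sq h0]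

open Classical in
/-- Coefficients with the same active groups as `θ₀` and close to `θ₀`. -/
noncomputable def nearCoef (X : Setup T) (θ₀ : Coef X.g) : Set (Coef X.g) :=
  Set.univ.pi fun j => if θ₀ j ≠ 0 then
    Metric.closedBall (θ₀ j) (1 / ((T : ℝ) ^ 2 * X.Z.groupNorm)) else {0}

lemma measurableSet_nearCoef (θ₀ : Coef X.g) : MeasurableSet (nearCoef X θ₀) := by
  refine MeasurableSet.univ_pi fun j => ?_
  split_ifs
  · exact Metric.isClosed_closedBall.measurableSet
  · exact measurableSet_singleton _

/-- The prior is a product: each of the `s₀` active groups pays the slab cost and a factor `1 - p`,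
each inactive one a factor `p`. -/
lemma coefPrior_nearCoef_ge (hX : Regime X cg Chi u dlo cπ) (hvlo : 0 < vlo) (hcg : 0 < cg)
    (hcθ : 0 < cθ) (hChi : 0 < Chi) {θ₀ : Coef X.g} (hθ₀ : θ₀ ∈ X.trueCoef cθ) {v p : ℝ}
    (hv : v ∈ Set.Icc vlo (2 * vhi)) (hp : p ∈ Set.Ioo (0 : ℝ) 1) :
    ENNReal.ofReal (Real.exp (-(slabConst vlo vhi cg cθ Chi * Real.log X.G)) ^ X.s0) *
      ENNReal.ofReal (p ^ (X.G - X.s0) * (1 - p) ^ X.s0) ≤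
      coefPrior X.g X.lam v p (nearCoef X θ₀) := by
  classical
  have hp1 : 0 ≤ 1 - p := by linarith [hp.2]
  have hv0 : 0 < v := hvlo.trans_le hv.1
  have hT0 : (0 : ℝ) < T := by have := hX.T_ge; positivity
  have hK := hX.groupNorm_pos
  have := fun j => isProbabilityMeasure_groupPrior (X.g_pos j) (X.lam_pos j) hv0
    ⟨hp.1.le, hp.2.le⟩
  have hs : (Finset.univ.filter (fun j => θ₀ j ≠ 0)).card = X.s0 := by
    rw [← hθ₀.2, numActive]
  rw [nearCoef, coefPrior, Measure.pi_pi]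
  calc _ = ∏ j, if θ₀ j ≠ 0 then ENNReal.ofReal (Real.exp (-(slabConst vlo vhi cg cθ Chi *
        Real.log X.G)) * (1 - p)) else ENNReal.ofReal p := by
        rw [Finset.prod_ite, Finset.prod_const, Finset.prod_const, hs, Finset.filter_not,
          Finset.card_sdiff_of_subset (Finset.filter_subset _ _), hs, Finset.card_univ,
          Fintype.card_fin, ← ENNReal.ofReal_pow (by positivity), ← ENNReal.ofReal_pow hp.1.le,
          ← ENNReal.ofReal_mul (by positivity), ← ENNReal.ofReal_mul (by positivity), mul_pow]
        congr 1; ring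
    _ ≤ _ := by
        refine Finset.prod_le_prod' fun j _ => ?_
        split_ifs with h
        · rw [groupPrior_apply, mul_comm, ENNReal.ofReal_mul hp1]
          refine le_trans ?_ le_self_add
          gcongr
          refine le_trans (ENNReal.ofReal_le_ofReal ?_) (mLaplace_closedBall_ge (X.g_pos j)
            (X.lam_pos j) hv0 (by positivity) (θ₀ j))
          exact exp_neg_slabConst_le hvlo hcg hcθ hChi hX.T_ge hX.one_le_logT hX.one_le_logG
            (hX.size_mul_le j) (hX.size_le j) hK (hX.le_lam j) (hX.lam_le j) (hX.lam_le' j)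
            (X.g_pos j) hv (norm_nonneg _) (norm_le_of_mem_trueCoef hθ₀ hcθ j)
        · rw [groupPrior_zero (X.g_pos j)]

/-- The radius `1 / (T² ‖Z‖_o)` is chosen so that `s₀ ≤ T` such perturbations together move the fit
by at most `1 / T`. -/
lemma sum_fit_sq_nearCoef_le (hX : Regime X cg Chi u dlo cπ) {θ₀ θ : Coef X.g}
    (hθ₀ : θ₀ ∈ X.trueCoef cθ) (hθ : θ ∈ nearCoef X θ₀) :
    ∑ t, X.Z.fit (θ - θ₀) t ^ 2 ≤ 1 / (T : ℝ) ^ 2 := by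
  classical
  have hT0 : (0 : ℝ) < T := by have := hX.T_ge; positivity
  have hK := hX.groupNorm_pos
  have hs : (Finset.univ.filter (fun j => θ₀ j ≠ 0)).card = X.s0 := by
    rw [← hθ₀.2, numActive]
  have h1 : ∑ j, ‖(θ - θ₀) j‖ ≤ X.s0 * (1 / ((T : ℝ) ^ 2 * X.Z.groupNorm)) := by
    calc _ ≤ ∑ j, if θ₀ j ≠ 0 then 1 / ((T : ℝ) ^ 2 * X.Z.groupNorm) else 0 := by
          refine Finset.sum_le_sum fun j _ => ?_
          have := hθ j (Set.mem_univ j)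
          beta_reduce at this
          split_ifs with h
          · rw [if_pos h] at this
            simpa [dist_eq_norm] using this
          · rw [if_neg h] at this
            push Not at h
            simp only [Set.mem_singleton_iff] at this
            simp [this, h]
      _ = _ := by rw [← Finset.sum_filter, Finset.sum_const, hs, nsmul_eq_mul]
  have h2 := norm_fit_le X.Z (θ - θ₀)
  have h3 : ‖(WithLp.toLp 2 (X.Z.fit (θ - θ₀)) : EuclideanSpace ℝ (Fin T))‖ ≤ 1 / T := by
    refine h2.trans ((mul_le_mul_of_nonneg_left h1 hK.le).trans ?_)
    have := hX.s0_le_T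
    calc _ = X.s0 / (T : ℝ) ^ 2 := by field_simp
      _ ≤ T / (T : ℝ) ^ 2 := by gcongr
      _ = _ := by field_simp
  rw [EuclideanSpace.norm_eq, Real.sqrt_le_left (by positivity)] at h3
  simpa [div_pow] using h3

lemma likelihood_nearCoef_ge (hX : Regime X cg Chi u dlo cπ) (hvlo : 0 < vlo) {θ₀ θ : Coef X.g}
    (hθ₀ : θ₀ ∈ X.trueCoef cθ) (hθ : θ ∈ nearCoef X θ₀) {v v₀ : ℝ} (hv₀ : vlo ≤ v₀)
    {y : Fin T → ℝ} (hy : |rss X.Z y θ₀ / (T * v₀) - 1| ≤ 1 / 4)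
    (hv : v ∈ Set.Icc v₀ (v₀ * (1 + 1 / T))) :
    ENNReal.ofReal (Real.exp (-((3 + 2 / vlo) / 2))) * likelihood X.Z y θ₀ v₀
      ≤ likelihood X.Z y θ v := by
  have hT3 : (3 : ℝ) ≤ T := by exact_mod_cast hX.T_ge
  have hT0 : (0 : ℝ) < T := by linarith
  have hv₀0 : 0 < v₀ := hvlo.trans_le hv₀
  have hv0 : 0 < v := hv₀0.trans_le hv.1
  rw [likelihood_eq _ _ _ hv0, likelihood_eq _ _ _ hv₀0, ← ENNReal.ofReal_mul (by positivity),
    ← Real.exp_add]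
  refine ENNReal.ofReal_le_ofReal (Real.exp_le_exp.mpr ?_)
  have hN0 : 0 ≤ rss X.Z y θ₀ := Finset.sum_nonneg fun _ _ => sq_nonneg _
  have hN : rss X.Z y θ₀ ≤ 5 / 4 * (T * v₀) := by
    have := (abs_le.mp hy).2
    rw [sub_le_iff_le_add, div_le_iff₀ (by positivity)] at this
    linarith
  have hδ := sum_fit_sq_nearCoef_le hX hθ₀ hθ
  have hQ : rss X.Z y θ ≤ rss X.Z y θ₀ + v₀ * (2 + 2 / vlo) := by
    -- Weighted AM–GM with weight `T`: the residual sum of squares over `T` is bounded, and `T`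
    -- times the squared perturbation is at most `1 / T`.
    have hcross : -(2 * ∑ t, (y t - X.Z.fit θ₀ t) * X.Z.fit (θ - θ₀) t) ≤
        rss X.Z y θ₀ / T + T * ∑ t, X.Z.fit (θ - θ₀) t ^ 2 := by
      rw [rss, Finset.sum_div, Finset.mul_sum, Finset.mul_sum, ← Finset.sum_neg_distrib,
        ← Finset.sum_add_distrib]
      refine Finset.sum_le_sum fun t _ => ?_
      set e := y t - X.Z.fit θ₀ t
      set f := X.Z.fit (θ - θ₀) t
      have : 0 ≤ (e + T * f) ^ 2 / T := by positivity
      have e2 : (e + T * f) ^ 2 / T = e ^ 2 / T + 2 * (e * f) + T * f ^ 2 := by field_simp; ring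
      linarith
    rw [rss_eq X.Z y θ θ₀]
    have h1 : rss X.Z y θ₀ / T ≤ 5 / 4 * v₀ := by
      rw [div_le_iff₀ hT0]; linarith
    have h2 : (T : ℝ) * ∑ t, X.Z.fit (θ - θ₀) t ^ 2 ≤ 1 := by
      calc _ ≤ (T : ℝ) * (1 / (T : ℝ) ^ 2) := by gcongr
        _ = 1 / T := by field_simp
        _ ≤ 1 := by rw [div_le_one hT0]; linarith
    have h3 : ∑ t, X.Z.fit (θ - θ₀) t ^ 2 ≤ 1 := by
      refine hδ.trans ?_
      rw [div_le_one (by positivity)]; nlinarith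
    have h4 : 2 ≤ v₀ * (2 / vlo) := by
      rw [mul_div_assoc', le_div_iff₀ hvlo]; linarith
    linarith
  have := le_gaussLogLik (by have := hX.T_ge; omega) hv₀0 hN0 (by positivity) hv hQ
  linarith

lemma jointMass_ge (hX : Regime X cg Chi u dlo cπ) (hvlo : 0 < vlo) (hcg : 0 < cg)
    (hcθ : 0 < cθ) (hChi : 0 < Chi) {θ₀ : Coef X.g}
    (hθ₀ : θ₀ ∈ X.trueCoef cθ) {v₀ : ℝ} (hv₀ : v₀ ∈ Set.Icc vlo vhi)
    {y : Fin T → ℝ} (hy : |rss X.Z y θ₀ / (T * v₀) - 1| ≤ 1 / 4) :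
    ENNReal.ofReal (Real.exp (-((3 + 2 / vlo) / 2))) * likelihood X.Z y θ₀ v₀ *
      ENNReal.ofReal (Real.exp (-(slabConst vlo vhi cg cθ Chi * Real.log X.G)) ^ X.s0) *
      invGammaMeasure a b (Set.Icc v₀ (v₀ * (1 + 1 / T))) *
      ENNReal.ofReal (betaMoment X.c X.d (X.G - X.s0) X.s0)
      ≤ X.jointMass a b y Set.univ := by
  have hT3 : (3 : ℝ) ≤ T := by exact_mod_cast hX.T_ge
  have hT0 : (0 : ℝ) < T := by linarith
  have hv₀0 : 0 < v₀ := hvlo.trans_le hv₀.1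
  set A := ENNReal.ofReal (Real.exp (-((3 + 2 / vlo) / 2))) * likelihood X.Z y θ₀ v₀ with hA
  set S := ENNReal.ofReal (Real.exp (-(slabConst vlo vhi cg cθ Chi * Real.log X.G)) ^ X.s0) with hS
  set I := Set.Icc v₀ (v₀ * (1 + 1 / (T : ℝ))) with hI
  rw [← lintegral_betaMeasure_pow X.c_pos X.d_pos, ← lintegral_const_mul _ (by fun_prop),
    Setup.jointMass]
  refine lintegral_mono_ae ((ae_betaMeasure_mem _ _).mono fun p hp => ?_)
  calc A * S * invGammaMeasure a b I * ENNReal.ofReal (p ^ (X.G - X.s0) * (1 - p) ^ X.s0)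
      = ∫⁻ v in I, A * (S * ENNReal.ofReal (p ^ (X.G - X.s0) * (1 - p) ^ X.s0))
          ∂(invGammaMeasure a b) := by
        rw [setLIntegral_const]; ring
    _ ≤ ∫⁻ v in I, ∫⁻ θ in Set.univ, likelihood X.Z y θ v ∂(coefPrior X.g X.lam v p)
          ∂(invGammaMeasure a b) := by
        refine setLIntegral_mono' measurableSet_Icc fun v hv => ?_
        have hv' : v ∈ Set.Icc vlo (2 * vhi) := by
          refine ⟨hv₀.1.trans hv.1, hv.2.trans ?_⟩
          have : 1 / (T : ℝ) ≤ 1 := by rw [div_le_one hT0]; linarith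
          nlinarith [hv₀.2]
        calc _ ≤ A * coefPrior X.g X.lam v p (nearCoef X θ₀) := by
              gcongr
              exact coefPrior_nearCoef_ge hX hvlo hcg hcθ hChi hθ₀ hv' hp
          _ = ∫⁻ θ in nearCoef X θ₀, A ∂(coefPrior X.g X.lam v p) := by rw [setLIntegral_const]
          _ ≤ ∫⁻ θ in nearCoef X θ₀, likelihood X.Z y θ v ∂(coefPrior X.g X.lam v p) :=
              setLIntegral_mono' (measurableSet_nearCoef θ₀) fun θ hθ =>
                likelihood_nearCoef_ge hX hvlo hθ₀ hθ hv₀.1 hy hv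
          _ ≤ _ := lintegral_mono_set (Set.subset_univ _)
    _ ≤ _ := setLIntegral_le_lintegral _ _

/-- The evidence is at least `exp (- C s₀ log G)` times the likelihood at the truth. -/
lemma exists_evidence_const (hvlo : 0 < vlo) (hvhi : vlo ≤ vhi) (hcg : 0 < cg)
    (hcθ : 0 < cθ) (hChi : 0 < Chi) (hu : 0 < u) (hdlo : 0 < dlo) (ha : 0 < a) (hb : 0 < b) :
    ∃ C : ℝ, 0 < C ∧ ∀ (T : ℕ) (X : Setup T), Regime X cg Chi u dlo cπ →
      ∀ θ₀ ∈ X.trueCoef cθ, ∀ v₀ ∈ Set.Icc vlo vhi, ∀ y : Fin T → ℝ,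
      |rss X.Z y θ₀ / (T * v₀) - 1| ≤ 1 / 4 →
      ENNReal.ofReal (Real.exp (-(C * (X.s0 * Real.log X.G)))) * likelihood X.Z y θ₀ v₀
        ≤ X.jointMass a b y Set.univ := by
  obtain ⟨κ, hκ, hκI⟩ := exists_invGammaMeasure_Icc_ge ha hb hvlo hvhi
  have hslab : 0 ≤ slabConst vlo vhi cg cθ Chi := by unfold slabConst; positivity
  refine ⟨(3 + 2 / vlo) / 2 + slabConst vlo vhi cg cθ Chi + |Real.log κ| + cg + |Real.log dlo|
    + |cπ| + 2, by positivity, fun T X hX θ₀ hθ₀ v₀ hv₀ y hy => ?_⟩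
  have hT3 : (3 : ℝ) ≤ T := by exact_mod_cast hX.T_ge
  have hT0 : (0 : ℝ) < T := by linarith
  have hG2 : (2 : ℝ) ≤ X.G := by exact_mod_cast hX.G_ge
  have hs1 : (1 : ℝ) ≤ X.s0 := by exact_mod_cast hX.s0_pos
  have hL := hX.one_le_logG
  have hc := X.c_pos
  have hd := X.d_pos
  refine le_trans ?_ (jointMass_ge hX hvlo hcg hcθ hChi hθ₀ hv₀ hy)
  set L := Real.log X.G with hLdef
  set s : ℝ := ((X.s0 : ℕ) : ℝ) with hs
  have hbm := betaMoment_ge hc hd hu (by have := hX.G_ge; omega) hX.beta_cond hX.s0_le_G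
  have hI := hκI v₀ hv₀ T (by linarith)
  calc _ ≤ ENNReal.ofReal (Real.exp (-((3 + 2 / vlo) / 2)) *
        (Real.exp (-(slabConst vlo vhi cg cθ Chi * L)) ^ X.s0) * (κ / T) *
        ((X.d / (X.G + X.c)) ^ X.s0 * (1 / ((X.G : ℝ) + 1)))) * likelihood X.Z y θ₀ v₀ := by
        gcongr
        have e1 : (X.d / (X.G + X.c)) ^ X.s0 = Real.exp (s * (Real.log X.d - Real.log (X.G + X.c))) := by
          rw [← Real.log_div (by positivity) (by positivity), hs, ← Real.log_pow,
            Real.exp_log (by positivity)]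
        have e2 : 1 / ((X.G : ℝ) + 1) = Real.exp (-Real.log (X.G + 1)) := by
          rw [Real.exp_neg, Real.exp_log (by positivity), one_div]
        have e3 : κ / T = Real.exp (Real.log κ - Real.log T) := by
          rw [← Real.log_div hκ.ne' hT0.ne', Real.exp_log (by positivity)]
        rw [e1, e2, e3, ← Real.exp_nat_mul, ← Real.exp_add, ← Real.exp_add, ← Real.exp_add,
          ← Real.exp_add, Real.exp_le_exp]
        -- Since `s₀ ≥ 1` and `log G ≥ 1`, every term is a multiple of `s₀ log G`. The summand 2 of
        -- the constant pays for `log (G + 1)`, and `cg` pays for the `log T` lost in the variance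
        -- prior.
        have b1 : Real.log (X.G + 1) ≤ 2 * L := by
          have : (X.G : ℝ) + 1 ≤ (X.G : ℝ) ^ 2 := by nlinarith
          have := Real.log_le_log (by positivity) this
          rw [Real.log_pow] at this
          exact_mod_cast this
        have b2 : -|Real.log dlo| ≤ Real.log X.d :=
          (neg_abs_le _).trans (Real.log_le_log hdlo hX.le_d)
        have b3 : Real.log (X.G + X.c) ≤ |cπ| * L :=
          hX.log_add_le.trans (mul_le_mul_of_nonneg_right (le_abs_self _) (by linarith))
        have b4 := neg_abs_le (Real.log κ)
        have b5 := hX.logT_le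
        have hsL : L ≤ s * L := by nlinarith
        have hsL1 : 1 ≤ s * L := by linarith
        have hsL2 : s ≤ s * L := by nlinarith
        have b6 : -(|Real.log dlo| * (s * L)) - |cπ| * (s * L) ≤
            s * (Real.log X.d - Real.log (X.G + X.c)) := by
          have c1 : -(s * |Real.log dlo|) ≤ s * Real.log X.d := by nlinarith
          have c2 : s * Real.log (X.G + X.c) ≤ s * (|cπ| * L) := by gcongr
          have c3 : s * |Real.log dlo| ≤ |Real.log dlo| * (s * L) := by
            rw [mul_comm]; exact mul_le_mul_of_nonneg_left hsL2 (abs_nonneg _)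
          linarith
        have b7 : (3 + 2 / vlo) / 2 ≤ (3 + 2 / vlo) / 2 * (s * L) :=
          le_mul_of_one_le_right (by positivity) hsL1
        have b8 : |Real.log κ| ≤ |Real.log κ| * (s * L) :=
          le_mul_of_one_le_right (abs_nonneg _) hsL1
        have b9 : cg * L ≤ cg * (s * L) := mul_le_mul_of_nonneg_left hsL hcg.le
        linarith
    _ = ENNReal.ofReal (Real.exp (-((3 + 2 / vlo) / 2))) * likelihood X.Z y θ₀ v₀ *
        ENNReal.ofReal (Real.exp (-(slabConst vlo vhi cg cθ Chi * L)) ^ X.s0) *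
        ENNReal.ofReal (κ / T) *
        ENNReal.ofReal ((X.d / (X.G + X.c)) ^ X.s0 * (1 / ((X.G : ℝ) + 1))) := by
        rw [ENNReal.ofReal_mul (by positivity), ENNReal.ofReal_mul (by positivity),
          ENNReal.ofReal_mul (by positivity)]
        ring
    _ ≤ _ := by gcongr

end Evidence

/-! ### Probabilities of the exceptional data. -/

section Events

variable {T : ℕ}

lemma dataLaw_rss_tail {G : ℕ} {g : Fin G → ℕ} (hT : 0 < T) (Z : Design T g) (θ₀ : Coef g)
    {v₀ ε : ℝ} (hv₀ : 0 < v₀) (hε : 0 < ε) :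
    dataLaw Z θ₀ v₀ {y | ε ≤ |rss Z y θ₀ / (T * v₀) - 1|} ≤
      ENNReal.ofReal (Var[fun x : ℝ => x ^ 2; gaussianReal 0 1] / (T * ε ^ 2)) := by
  have hm : Measurable fun y => rss Z y θ₀ := by unfold rss; fun_prop
  rw [dataLaw_eq_map Z θ₀ hv₀.le, Measure.map_apply (by fun_prop)
    (measurableSet_le measurable_const (by fun_prop))]
  refine (measure_mono fun z hz => ?_).trans (stdNormal_meanSq_tail hT hε)
  simp only [Set.mem_preimage, Set.mem_ofPred_eq] at hz ⊢
  have e : rss Z (fun t => Z.fit θ₀ t + √v₀ * z t) θ₀ = v₀ * ∑ t, z t ^ 2 := by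
    simp [rss, mul_pow, Real.sq_sqrt hv₀.le, Finset.mul_sum]
  have e2 : (v₀ * ∑ t, z t ^ 2) / (T * v₀) = (∑ t, z t ^ 2) / T := by field_simp
  rw [e, e2] at hz
  exact hz

/-- A fit with at most `k` active groups lies in the span of at most `k` blocks, of dimension at
most `k cg log G`. There are at most `exp ((2 + k) log G)` such spans, so the supremum over all `h`
becomes a finite union of projection events. -/
lemma dataLaw_cross_tail {X : Setup T} {cg Chi u dlo cπ : ℝ} (hX : Regime X cg Chi u dlo cπ)
    (hcg : 0 < cg) (θ₀ : Coef X.g) {v₀ k R : ℝ} (hv₀ : 0 < v₀) :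
    dataLaw X.Z θ₀ v₀ {y | ∃ h : Coef X.g, (numActive h : ℝ) ≤ k ∧
      R * v₀ * ∑ t, X.Z.fit h t ^ 2 < (∑ t, (y t - X.Z.fit θ₀ t) * X.Z.fit h t) ^ 2} ≤
      ENNReal.ofReal (Real.exp ((2 + k + k * cg) * Real.log X.G - R / 4)) := by
  classical
  set L := Real.log X.G with hL
  have hG2 : (2 : ℝ) ≤ X.G := by exact_mod_cast hX.G_ge
  have hL1 : 1 ≤ L := hX.one_le_logG
  -- The event is an uncountable union whose measurability is not established; along a measurable
  -- embedding the image measure is computed on arbitrary sets.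
  have hemb : MeasurableEmbedding fun (z : Fin T → ℝ) t => X.Z.fit θ₀ t + √v₀ * z t := by
    have hs : √v₀ ≠ 0 := (Real.sqrt_pos.mpr hv₀).ne'
    exact (MeasurableEquiv.addLeft (X.Z.fit θ₀)).measurableEmbedding.comp
      (measurableEmbedding_const_smul₀ hs)
  rw [dataLaw_eq_map X.Z θ₀ hv₀.le, hemb.map_apply]
  set E : Finset (Fin X.G) → Set (Fin T → ℝ) := fun S =>
    {z | ∃ x ∈ groupSpan X.Z S, R * ‖x‖ ^ 2 < (inner ℝ (WithLp.toLp 2 z) x) ^ 2} with hE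
  have hsub : (fun (z : Fin T → ℝ) t => X.Z.fit θ₀ t + √v₀ * z t) ⁻¹'
      {y | ∃ h : Coef X.g, (numActive h : ℝ) ≤ k ∧
      R * v₀ * ∑ t, X.Z.fit h t ^ 2 < (∑ t, (y t - X.Z.fit θ₀ t) * X.Z.fit h t) ^ 2} ⊆
      ⋃ S ∈ (Finset.univ : Finset (Finset (Fin X.G))).filter (fun S => (S.card : ℝ) ≤ k), E S := by
    rintro z ⟨h, hh, hz⟩
    simp only [Set.mem_iUnion]
    refine ⟨Finset.univ.filter (fun j => h j ≠ 0), ?_, WithLp.toLp 2 (X.Z.fit h), ?_, ?_⟩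
    · simp only [Finset.mem_filter, Finset.mem_univ, true_and]
      simpa [numActive] using hh
    · exact fit_mem_groupSpan X.Z fun j hj => by simpa using hj
    · have e1 : ‖(WithLp.toLp 2 (X.Z.fit h) : EuclideanSpace ℝ (Fin T))‖ ^ 2
          = ∑ t, X.Z.fit h t ^ 2 := by
        rw [EuclideanSpace.norm_sq_eq]; simp
      have e2 : inner ℝ (WithLp.toLp 2 z : EuclideanSpace ℝ (Fin T)) (WithLp.toLp 2 (X.Z.fit h))
          = ∑ t, z t * X.Z.fit h t := by
        simp [PiLp.inner_apply, mul_comm]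
      rw [e1, e2]
      have e3 : ∑ t, (X.Z.fit θ₀ t + √v₀ * z t - X.Z.fit θ₀ t) * X.Z.fit h t
          = √v₀ * ∑ t, z t * X.Z.fit h t := by
        rw [Finset.mul_sum]
        exact Finset.sum_congr rfl fun t _ => by ring
      rw [e3, mul_pow, Real.sq_sqrt hv₀.le] at hz
      refine lt_of_mul_lt_mul_left (a := v₀) ?_ hv₀.le
      linarith
  have hsize : ∀ j, (X.g j : ℝ) ≤ cg * L := fun j => by
    have := hX.size_mul_le j
    have h1 := hX.one_le_logT
    nlinarith [(Nat.cast_nonneg (X.g j) : (0 : ℝ) ≤ X.g j)]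
  have hES : ∀ S : Finset (Fin X.G), (S.card : ℝ) ≤ k →
      stdNormal T (E S) ≤ ENNReal.ofReal (Real.exp (k * cg * L - R / 4)) := by
    intro S hS
    refine (stdNormal_subspace_tail (groupSpan X.Z S) R).trans ?_
    rw [← ENNReal.ofReal_pow (by positivity), ← ENNReal.ofReal_mul (by positivity)]
    refine ENNReal.ofReal_le_ofReal ?_
    have h1 : √2 ≤ Real.exp 1 := by
      have : √2 ≤ 2 := by rw [Real.sqrt_le_left (by norm_num)]; norm_num
      linarith [Real.add_one_le_exp 1]
    have h2 : ((Module.finrank ℝ (groupSpan X.Z S) : ℕ) : ℝ) ≤ k * cg * L := by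
      calc ((Module.finrank ℝ (groupSpan X.Z S) : ℕ) : ℝ) ≤ ∑ j ∈ S, (X.g j : ℝ) := by
            exact_mod_cast finrank_groupSpan_le X.Z S
        _ ≤ ∑ j ∈ S, cg * L := Finset.sum_le_sum fun j _ => hsize j
        _ = S.card * (cg * L) := by rw [Finset.sum_const, nsmul_eq_mul]
        _ ≤ k * (cg * L) := by gcongr
        _ = _ := by ring
    calc _ ≤ Real.exp (-R / 4) * Real.exp 1 ^ Module.finrank ℝ (groupSpan X.Z S) := by gcongr
      _ = Real.exp (Module.finrank ℝ (groupSpan X.Z S) - R / 4) := by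
          rw [← Real.exp_nat_mul, ← Real.exp_add]; congr 1; ring
      _ ≤ _ := by gcongr
  refine (measure_mono hsub).trans ((measure_biUnion_finset_le _ _).trans ?_)
  refine (Finset.sum_le_sum fun S hS => hES S (Finset.mem_filter.mp hS).2).trans ?_
  rw [Finset.sum_const, nsmul_eq_mul, ← ENNReal.ofReal_natCast, ← ENNReal.ofReal_mul (by positivity)]
  refine ENNReal.ofReal_le_ofReal ?_
  have hcard : ((((Finset.univ : Finset (Finset (Fin X.G))).filter
      (fun S => (S.card : ℝ) ≤ k)).card : ℕ) : ℝ) ≤ Real.exp ((2 + k) * L) := by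
    have h1 := Finset.sum_powerset_apply_card (x := (Finset.univ : Finset (Fin X.G)))
      (fun s => if ((s : ℕ) : ℝ) ≤ k then (1 : ℝ) else 0)
    rw [Finset.powerset_univ, Finset.card_univ, Fintype.card_fin] at h1
    rw [Finset.card_filter]
    push_cast
    rw [h1]
    have hexp : Real.exp L = X.G := Real.exp_log (by linarith)
    calc _ ≤ ∑ s ∈ Finset.range (X.G + 1), Real.exp (k * L) := by
          refine Finset.sum_le_sum fun s _ => ?_
          split_ifs with h
          · rw [nsmul_eq_mul, mul_one]
            calc ((X.G.choose s : ℕ) : ℝ) ≤ (X.G : ℝ) ^ s := by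
                  exact_mod_cast Nat.choose_le_pow X.G s
              _ = Real.exp (s * L) := by rw [Real.exp_nat_mul, hexp]
              _ ≤ _ := by gcongr
          · rw [smul_zero]; positivity
      _ = ((X.G : ℝ) + 1) * Real.exp (k * L) := by
          rw [Finset.sum_const, Finset.card_range, nsmul_eq_mul]; push_cast; rfl
      _ ≤ (X.G : ℝ) ^ 2 * Real.exp (k * L) := by
          gcongr; nlinarith
      _ = _ := by
          rw [← hexp, ← Real.exp_nat_mul, ← Real.exp_add]; congr 1; push_cast; ring
  calc _ ≤ Real.exp ((2 + k) * L) * Real.exp (k * cg * L - R / 4) := by gcongr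
    _ = _ := by rw [← Real.exp_add]; congr 1; ring

end Events

/-! ### Splitting the posterior and bounding it at a fixed sample size. -/

section Posterior

variable {T : ℕ} (X : Setup T) {a b : ℝ}

/-- The prior has total mass at most one, so a pointwise bound survives integration. It must hold
for all `v`, since the variance is not restricted to a sieve. -/
lemma jointMass_le_add (ha : 0 < a) (hb : 0 < b) {y : Fin T → ℝ} {B N : Set (Coef X.g)}
    (hB : MeasurableSet B) (hN : MeasurableSet N) {K : ℝ≥0∞}
    (hK : ∀ θ ∈ B \ N, ∀ v > 0, likelihood X.Z y θ v ≤ K) :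
    X.jointMass a b y B ≤ X.jointMass a b y N + K := by
  have := isProbabilityMeasure_invGammaMeasure ha hb
  have := isProbabilityMeasureBeta X.c_pos X.d_pos
  unfold Setup.jointMass
  calc _ ≤ ∫⁻ p, ∫⁻ v, ((∫⁻ θ in N, likelihood X.Z y θ v ∂(coefPrior X.g X.lam v p)) + K)
        ∂(invGammaMeasure a b) ∂(betaMeasure X.c X.d) := by
        refine lintegral_mono_ae ((ae_betaMeasure_mem _ _).mono fun p hp => ?_)
        refine lintegral_mono_ae ((ae_invGammaMeasure_pos a b).mono fun v hv => ?_)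
        have := isProbabilityMeasure_coefPrior X.g_pos X.lam_pos hv ⟨hp.1.le, hp.2.le⟩
        have hsub : B ⊆ N ∪ B \ N := by rw [Set.union_sdiff_self]; exact Set.subset_union_right
        refine (lintegral_mono_set hsub).trans ((lintegral_union_le _ _ _).trans ?_)
        gcongr
        refine (setLIntegral_mono' (hB.diff hN) fun θ hθ => hK θ hθ v hv).trans ?_
        rw [setLIntegral_const]
        exact mul_le_of_le_one_right' prob_le_one
    _ = _ := by
        simp_rw [lintegral_add_right _ measurable_const]
        simp

lemma measurableSet_radius_le (r : ℝ≥0∞) (θ₀ : Coef X.g) :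
    MeasurableSet {θ : Coef X.g | r ≤ ENNReal.ofReal (normSq (θ - θ₀))} := by
  have : Measurable fun θ : Coef X.g => normSq (θ - θ₀) := by
    unfold normSq
    refine Finset.measurable_sum _ fun j _ => ?_
    have : Measurable fun θ : Coef X.g => (θ - θ₀) j := (measurable_pi_apply j).sub_const _
    fun_prop
  exact measurableSet_le measurable_const this.ennreal_ofReal

/-- The likelihood of sparse coefficients far from the truth is small. -/
lemma likelihood_far_le {X : Setup T} {cg Chi u dlo cπ cθ vlo vhi k ε M ρ : ℝ}
    (hX : Regime X cg Chi u dlo cπ) (hvlo : 0 < vlo) (hM : 0 < M)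
    {θ₀ : Coef X.g} (hθ₀ : θ₀ ∈ X.trueCoef cθ) {v₀ : ℝ} (hv₀ : v₀ ∈ Set.Icc vlo vhi)
    (hε : ε = X.eps) (hMε : M * ε ^ 2 / (2 * vhi) ≤ 1 / 4)
    (hρ : 16 * vhi * ρ ≤ M) {y : Fin T → ℝ}
    (hy1 : |rss X.Z y θ₀ / (T * v₀) - 1| ≤ ε)
    (hy2 : ∀ h : Coef X.g, (numActive h : ℝ) ≤ X.s0 + k →
      (∑ t, (y t - X.Z.fit θ₀ t) * X.Z.fit h t) ^ 2 ≤
        (ρ * (T * ε ^ 2)) * v₀ * ∑ t, X.Z.fit h t ^ 2)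
    {θ : Coef X.g} (hk : (numActive θ : ℝ) ≤ k)
    (hr : ENNReal.ofReal (M * T * ε ^ 2) / (X.Z.phi (X.s0 + k) *
      ENNReal.ofReal (X.Z.groupNorm ^ 2)) ≤ ENNReal.ofReal (normSq (θ - θ₀)))
    {v : ℝ} (hv : 0 < v) :
    likelihood X.Z y θ v ≤
      ENNReal.ofReal (Real.exp (-((M / (8 * vhi) - 1) * (T * ε ^ 2)))) *
        likelihood X.Z y θ₀ v₀ := by
  have hT0 : (0 : ℝ) < T := by have := hX.T_ge; positivity
  have hε0 : 0 < ε := hε ▸ hX.eps_pos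
  have hv₀0 : 0 < v₀ := hvlo.trans_le hv₀.1
  have hvhi0 : 0 < vhi := hv₀0.trans_le hv₀.2
  have hk0 : 0 ≤ k := le_trans (Nat.cast_nonneg _) hk
  have hact : (numActive (θ - θ₀) : ℝ) ≤ X.s0 + k := by
    have h1 : ((numActive (θ - θ₀) : ℕ) : ℝ) ≤ numActive θ + numActive θ₀ := by
      exact_mod_cast numActive_sub_le θ θ₀
    rw [hθ₀.2] at h1
    linarith
  have hθ₀ne : θ₀ ≠ 0 := by
    rintro rfl
    have h1 := hθ₀.2
    have h2 := hX.s0_pos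
    simp [numActive] at h1
    omega
  have hφ : X.Z.phi (X.s0 + k) ≠ ∞ :=
    phi_ne_top X.Z hX.groupNorm_pos hθ₀ne (by rw [hθ₀.2]; linarith)
  have hA : 0 < M * T * ε ^ 2 := by positivity
  have hδ := le_sum_fit_sq_of_le_normSq X.Z hX.groupNorm_pos hA hact hφ hr
  have hcr := hy2 (θ - θ₀) hact
  set D := ∑ t, X.Z.fit (θ - θ₀) t ^ 2 with hD
  set W := ∑ t, (y t - X.Z.fit θ₀ t) * X.Z.fit (θ - θ₀) t with hW
  have hD0 : 0 < D := hA.trans_le hδ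
  -- The noise event gives `W² ≤ ρ T ε² v₀ D`, and the size of `M` gives `16 ρ T ε² v₀ ≤ D`; hence
  -- the cross term removes at most half of `D`.
  have hWD : 2 * W ≤ D / 2 := by
    have h1 : 16 * (ρ * (T * ε ^ 2) * v₀) ≤ D := by
      rcases le_or_gt 0 ρ with h | h
      · calc 16 * (ρ * (T * ε ^ 2) * v₀) ≤ 16 * (ρ * (T * ε ^ 2) * vhi) := by
              have := hv₀.2; gcongr
          _ = (16 * vhi * ρ) * (T * ε ^ 2) := by ring
          _ ≤ M * (T * ε ^ 2) := by gcongr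
          _ ≤ D := by linarith
      · have : 0 ≤ -ρ * (T * ε ^ 2) * v₀ := by
          have : 0 < -ρ := by linarith
          positivity
        linarith
    have h2 : (4 * W) ^ 2 ≤ D ^ 2 := by nlinarith
    have := abs_le_of_sq_le_sq' h2 hD0.le
    linarith [this.2]
  have hQ : rss X.Z y θ₀ + T * v₀ * (M * ε ^ 2 / (2 * vhi)) ≤ rss X.Z y θ := by
    rw [rss_eq X.Z y θ θ₀]
    have h1 : T * v₀ * (M * ε ^ 2 / (2 * vhi)) ≤ M * T * ε ^ 2 / 2 := by
      rw [mul_div_assoc', div_le_div_iff₀ (by positivity) (by norm_num)]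
      have := hv₀.2
      have : M * T * ε ^ 2 * v₀ ≤ M * T * ε ^ 2 * vhi := by gcongr
      linarith
    linarith
  have hlik := gaussLogLik_le (by have := hX.T_ge; omega) hv hv₀0 hy1 (hε ▸ hX.eps_le)
    (by positivity) hMε hQ
  rw [likelihood_eq _ _ _ hv, likelihood_eq _ _ _ hv₀0, ← ENNReal.ofReal_mul (by positivity),
    ← Real.exp_add]
  refine ENNReal.ofReal_le_ofReal (Real.exp_le_exp.mpr (hlik.trans (le_of_eq ?_)))
  field_simp
  ring

/-- The posterior contraction bound for a single sample size. -/
lemma lintegral_posterior_le {X : Setup T} {cg Chi u dlo cπ cθ vlo vhi C M M₂ : ℝ}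
    (hX : Regime X cg Chi u dlo cπ) (hvlo : 0 < vlo) (hcg : 0 < cg) (hu : 0 < u)
    (ha : 0 < a) (hb : 0 < b) (hC : 0 < C)
    (hM₂ : 0 < M₂) (huM₂ : C + 3 ≤ u * M₂) (hM : 0 < M)
    (hM1 : 16 * vhi * (4 * (3 + (1 + M₂ * (1 + cg)) * (1 + cg))) ≤ M)
    (hM2 : C + 1 ≤ M / (8 * vhi) - 1)
    (hMε : M * X.eps ^ 2 / (2 * vhi) ≤ 1 / 4)
    {θ₀ : Coef X.g} (hθ₀ : θ₀ ∈ X.trueCoef cθ) {v₀ : ℝ} (hv₀ : v₀ ∈ Set.Icc vlo vhi)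
    (hev : ∀ y : Fin T → ℝ, |rss X.Z y θ₀ / (T * v₀) - 1| ≤ 1 / 4 →
      ENNReal.ofReal (Real.exp (-(C * (X.s0 * Real.log X.G)))) * likelihood X.Z y θ₀ v₀
        ≤ X.jointMass a b y Set.univ) :
    ∫⁻ y, X.posterior a b y {θ | X.radius M M₂ ≤ ENNReal.ofReal (normSq (θ - θ₀))}
      ∂(dataLaw X.Z θ₀ v₀) ≤
      ENNReal.ofReal (Var[fun x : ℝ => x ^ 2; gaussianReal 0 1] / Real.log T) +
        3 * ENNReal.ofReal (Real.exp (-Real.log X.G)) := by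
  have hT0 : (0 : ℝ) < T := by have := hX.T_ge; positivity
  have hTn : 0 < T := by have := hX.T_ge; omega
  have hv₀0 : 0 < v₀ := hvlo.trans_le hv₀.1
  have hvhi0 : 0 < vhi := hv₀0.trans_le hv₀.2
  have hs1 : (1 : ℝ) ≤ X.s0 := by exact_mod_cast hX.s0_pos
  have hL := hX.one_le_logG
  have hG2 : (2 : ℝ) ≤ X.G := by exact_mod_cast hX.G_ge
  set L := Real.log X.G with hLdef
  set s : ℝ := ((X.s0 : ℕ) : ℝ) with hs
  set ε := X.eps with hε
  have hsL : L ≤ s * L := by nlinarith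
  -- `ck` bounds `s₀ + k` by a multiple of `s₀`, and `ρ / 4` exceeds the entropy exponent `2 + (s₀ +
  -- k)(1 + cg)` with one `log G` to spare.
  set ck := 1 + M₂ * (1 + cg) with hck
  set ρ := 4 * (3 + ck * (1 + cg)) with hρ
  have hρ0 : 0 < ρ := by positivity
  set k := M₂ * X.sTilde with hk
  have hk0 : 0 ≤ k := mul_nonneg hM₂.le (by linarith [hX.s0_le_sTilde])
  have hkle : s + k ≤ ck * s := by
    have := mul_le_mul_of_nonneg_left hX.sTilde_le hM₂.le
    rw [hck, hk]; linarith
  set Bad1 : Set (Fin T → ℝ) := {y | ε ≤ |rss X.Z y θ₀ / (T * v₀) - 1|} with hBad1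
  set Bad2 : Set (Fin T → ℝ) := {y | ∃ h : Coef X.g, (numActive h : ℝ) ≤ s + k ∧
      ρ * (T * ε ^ 2) * v₀ * ∑ t, X.Z.fit h t ^ 2 <
        (∑ t, (y t - X.Z.fit θ₀ t) * X.Z.fit h t) ^ 2} with hBad2
  set P := dataLaw X.Z θ₀ v₀ with hP
  have hP1 : P Bad1 ≤ ENNReal.ofReal (Var[fun x : ℝ => x ^ 2; gaussianReal 0 1] / Real.log T) := by
    refine (dataLaw_rss_tail hTn X.Z θ₀ hv₀0 hX.eps_pos).trans (ENNReal.ofReal_le_ofReal ?_)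
    have h1 := hX.one_le_logT
    have h2 := variance_nonneg (fun x : ℝ => x ^ 2) (gaussianReal 0 1)
    exact div_le_div_of_nonneg_left h2 (by linarith) hX.logT_le_eps
  have hP2 : P Bad2 ≤ ENNReal.ofReal (Real.exp (-L)) := by
    refine (dataLaw_cross_tail hX hcg θ₀ hv₀0).trans
      (ENNReal.ofReal_le_ofReal (Real.exp_le_exp.mpr ?_))
    have h1 : ρ * (s * L) ≤ ρ * (T * ε ^ 2) := mul_le_mul_of_nonneg_left hX.le_eps hρ0.le
    have h2 : (s + k) * (1 + cg) * L ≤ ck * s * (1 + cg) * L := by gcongr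
    have h3 : ρ * (s * L) = 12 * (s * L) + 4 * (ck * s * (1 + cg) * L) := by rw [hρ]; ring
    linarith
  set N : Set (Coef X.g) := {θ | k < (numActive θ : ℝ)} with hN
  have hNm : MeasurableSet N := measurableSet_lt_numActive k
  set B : Set (Coef X.g) := {θ | X.radius M M₂ ≤ ENNReal.ofReal (normSq (θ - θ₀))} with hB
  set e := ENNReal.ofReal (Real.exp (C * (s * L))) with he
  -- A measurable hull of equal probability: the integral of its indicator then splits off, with no
  -- measurability of the posterior in `y` required.
  set Bad := toMeasurable P (Bad1 ∪ Bad2) with hBad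
  have hpt : ∀ y, X.posterior a b y B ≤ Bad.indicator 1 y + ENNReal.ofReal (Real.exp (-L)) +
      e * (X.jointMass a b y N / likelihood X.Z y θ₀ v₀) := by
    intro y
    by_cases hyB : y ∈ Bad
    · rw [Set.indicator_of_mem hyB, add_assoc]
      refine le_trans ?_ le_self_add
      refine ENNReal.div_le_of_le_mul ?_
      rw [Pi.one_apply, one_mul]
      exact lintegral_mono fun p => lintegral_mono fun v => lintegral_mono_set (Set.subset_univ _)
    · have hyn : y ∉ Bad1 ∪ Bad2 := fun h => hyB (subset_toMeasurable _ _ h)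
      simp only [Set.mem_union, not_or] at hyn
      have hy1 : |rss X.Z y θ₀ / (T * v₀) - 1| ≤ ε := (not_le.mp hyn.1).le
      have hy2 : ∀ h : Coef X.g, (numActive h : ℝ) ≤ s + k →
          (∑ t, (y t - X.Z.fit θ₀ t) * X.Z.fit h t) ^ 2 ≤
          (ρ * (T * ε ^ 2)) * v₀ * ∑ t, X.Z.fit h t ^ 2 := fun h hh => by
        by_contra hc
        exact hyn.2 ⟨h, hh, not_le.mp hc⟩
      set l₀ := likelihood X.Z y θ₀ v₀ with hl₀
      have hl0 : l₀ ≠ 0 := (likelihood_pos X.Z y θ₀ hv₀0).ne'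
      have hlt : l₀ ≠ ∞ := likelihood_ne_top X.Z y θ₀ hv₀0
      have hnum : X.jointMass a b y B ≤ X.jointMass a b y N +
          ENNReal.ofReal (Real.exp (-((M / (8 * vhi) - 1) * (T * ε ^ 2)))) * l₀ :=
        jointMass_le_add X ha hb (y := y) (measurableSet_radius_le X _ θ₀) hNm
        (K := ENNReal.ofReal (Real.exp (-((M / (8 * vhi) - 1) * (T * ε ^ 2)))) * l₀)
        (fun θ hθ v hv => likelihood_far_le hX hvlo hM hθ₀ hv₀ hε hMε hM1 hy1 hy2
          (not_lt.mp hθ.2) hθ.1 hv)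
      have hden := hev y (hy1.trans hX.eps_le)
      have hinv : (X.jointMass a b y Set.univ)⁻¹ ≤ e * l₀⁻¹ := by
        refine (ENNReal.inv_le_inv.mpr hden).trans (le_of_eq ?_)
        rw [ENNReal.mul_inv (Or.inr hlt) (Or.inr hl0), ← ENNReal.ofReal_inv_of_pos (Real.exp_pos _),
          ← Real.exp_neg, neg_neg]
      rw [Set.indicator_of_notMem hyB, zero_add, Setup.posterior, div_eq_mul_inv]
      calc _ ≤ (X.jointMass a b y N +
            ENNReal.ofReal (Real.exp (-((M / (8 * vhi) - 1) * (T * ε ^ 2)))) * l₀) *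
            (e * l₀⁻¹) := by gcongr
        _ = ENNReal.ofReal (Real.exp (-((M / (8 * vhi) - 1) * (T * ε ^ 2)))) * e * (l₀ * l₀⁻¹) +
            e * (X.jointMass a b y N / l₀) := by
            rw [div_eq_mul_inv (X.jointMass a b y N)]; ring
        _ ≤ _ := by
            rw [ENNReal.mul_inv_cancel hl0 hlt, mul_one]
            gcongr
            rw [he, ← ENNReal.ofReal_mul (by positivity), ← Real.exp_add]
            refine ENNReal.ofReal_le_ofReal (Real.exp_le_exp.mpr ?_)
            -- Of `C + 1`, the part `C` cancels the inverse evidence and the rest leaves `exp (-log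
            -- G)`.
            have h1 : (C + 1) * (s * L) ≤ (M / (8 * vhi) - 1) * (T * ε ^ 2) :=
              mul_le_mul hM2 hX.le_eps (by positivity) (by linarith)
            linarith
  have hNint : ∫⁻ y, e * (X.jointMass a b y N / likelihood X.Z y θ₀ v₀) ∂P ≤
      ENNReal.ofReal (Real.exp (-L)) := by
    rw [lintegral_const_mul' _ _ ENNReal.ofReal_ne_top]
    have h1 := (lintegral_jointMass_div_le X ha hb hNm θ₀ hv₀0).trans
      (prior_lt_numActive_le X.g_pos X.lam_pos X.c_pos X.d_pos hu ha hb
        (by have := hX.G_ge; omega) hX.beta_cond)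
    refine (mul_le_mul_right h1 e).trans ?_
    rw [he, ← ENNReal.ofReal_mul (by positivity)]
    refine ENNReal.ofReal_le_ofReal ?_
    have h2 : (X.G : ℝ) + 1 ≤ Real.exp (2 * L) := by
      have hexp : Real.exp L = X.G := Real.exp_log (by linarith)
      rw [two_mul, Real.exp_add, hexp]; nlinarith
    have h3 : (X.G : ℝ) ^ (-(u * k)) = Real.exp (L * -(u * k)) :=
      Real.rpow_def_of_pos (by linarith) _
    rw [h3]
    calc _ ≤ Real.exp (C * (s * L)) * (Real.exp (2 * L) * Real.exp (L * -(u * k))) := by gcongr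
      _ = Real.exp (C * (s * L) + 2 * L + L * -(u * k)) := by
          rw [← Real.exp_add, ← Real.exp_add]; congr 1; ring
      _ ≤ _ := by
          rw [Real.exp_le_exp]
          -- This is where `M₂ ≥ (C + 3) / u` enters: `C` cancels the inverse evidence, 2 pays for
          -- the factor `G + 1`, and 1 is left as decay.
          have h4 : (C + 3) * s ≤ u * k := by
            rw [hk, ← mul_assoc]
            exact mul_le_mul huM₂ hX.s0_le_sTilde (by linarith) (by positivity)
          have h5 : L * ((C + 3) * s) ≤ L * (u * k) := by gcongr
          nlinarith
  calc _ ≤ ∫⁻ y, (Bad.indicator 1 y + ENNReal.ofReal (Real.exp (-L)) +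
        e * (X.jointMass a b y N / likelihood X.Z y θ₀ v₀)) ∂P := lintegral_mono hpt
    _ = P Bad + ENNReal.ofReal (Real.exp (-L)) +
        ∫⁻ y, e * (X.jointMass a b y N / likelihood X.Z y θ₀ v₀) ∂P := by
        have hm : Measurable (Bad.indicator (1 : (Fin T → ℝ) → ℝ≥0∞)) :=
          measurable_one.indicator (measurableSet_toMeasurable _ _)
        rw [lintegral_add_left (f := fun y => Bad.indicator 1 y + ENNReal.ofReal (Real.exp (-L)))
          (hm.add measurable_const), lintegral_add_left hm,
          lintegral_indicator_one (measurableSet_toMeasurable _ _), lintegral_const, hP,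
          measure_univ, mul_one]
    _ ≤ (ENNReal.ofReal (Var[fun x : ℝ => x ^ 2; gaussianReal 0 1] / Real.log T) +
        ENNReal.ofReal (Real.exp (-L))) + ENNReal.ofReal (Real.exp (-L)) +
        ENNReal.ofReal (Real.exp (-L)) := by
        gcongr
        rw [hBad, measure_toMeasurable]
        exact (measure_union_le _ _).trans (add_le_add hP1 hP2)
    _ = _ := by ring

end Posterior

/-! ### From the asymptotic assumptions to the theorem. -/

lemma Regime.of_conditions {T : ℕ} {X : Setup T} {cg clo Chi u dlo cπ cθ : ℝ} (hcg : 0 < cg)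
    (hclo : 1 < clo) (hChi : 0 < Chi) (hdlo : 0 < dlo) (hT : 3 ≤ T) (hl : 1 ≤ Real.log T)
    (hlcg : cg ≤ Real.log T) (hsize : X.GroupSizeCond cg) (hpen : X.PenaltyCond clo Chi)
    (hbeta : X.BetaCond u dlo cπ) (heps : X.eps ≤ 1 / 4) {θ₀ : Coef X.g}
    (hθ₀ : θ₀ ∈ X.trueCoef cθ) : Regime X cg Chi u dlo cπ := by
  have hT3 : (3 : ℝ) ≤ T := by exact_mod_cast hT
  have hT0 : (0 : ℝ) < T := by linarith
  -- `dlo ≤ d ≤ s₀` with `dlo > 0` rules out an empty true model.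
  have hs0 : 1 ≤ X.s0 := by
    have : (0 : ℝ) < X.s0 := lt_of_lt_of_le hdlo (hbeta.2.1.trans hbeta.2.2.1)
    exact_mod_cast this
  have hs1 : (1 : ℝ) ≤ X.s0 := by exact_mod_cast hs0
  have hsG : X.s0 ≤ X.G := by
    rw [← hθ₀.2, numActive]
    exact (Finset.card_le_univ _).trans (by simp)
  have hsm : ∀ j, (X.g j : ℝ) * Real.log T ≤ cg * Real.log X.G := fun j => by
    have := hsize j
    rwa [le_div_iff₀ (by linarith)] at this
  have hGpos : 0 < X.G := by omega
  let j₀ : Fin X.G := ⟨0, hGpos⟩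
  have hlL : Real.log T ≤ cg * Real.log X.G := by
    refine le_trans ?_ (hsm j₀)
    have : (1 : ℝ) ≤ X.g j₀ := by exact_mod_cast X.g_pos j₀
    nlinarith
  -- A nonempty group has size at least one, so the size condition gives `log T ≤ cg log G`; with
  -- `cg ≤ log T` this yields the claim.
  have hL : 1 ≤ Real.log X.G := by nlinarith
  have hG2 : 2 ≤ X.G := by
    by_contra hc
    have : X.G = 1 := by omega
    rw [this] at hL
    norm_num at hL
  -- A vanishing design norm would make the upper bound on the positive `lam` nonpositive.
  have hK : 0 < X.Z.groupNorm := by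
    by_contra hc
    have h1 := (hpen.2 j₀).2
    have h2 : Chi * min (√(Real.log T)) (√(Real.log X.G) * X.Z.groupNorm) ≤ 0 :=
      mul_nonpos_of_nonneg_of_nonpos hChi.le ((min_le_right _ _).trans
        (mul_nonpos_of_nonneg_of_nonpos (Real.sqrt_nonneg _) (not_lt.mp hc)))
    linarith [X.lam_pos j₀]
  have heps0 : 0 < X.eps := lt_of_lt_of_le (Real.sqrt_pos.mpr (by positivity)) (le_max_right _ _)
  have hsq : ∀ x, 0 ≤ x → √(x / T) ≤ X.eps → x ≤ T * X.eps ^ 2 := fun x hx h => by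
    rw [Real.sqrt_le_left heps0.le, div_le_iff₀ hT0] at h
    linarith
  have hle := hsq _ (by positivity : 0 ≤ X.s0 * Real.log X.G) (le_max_left _ _)
  have hle2 := hsq _ (by linarith : 0 ≤ Real.log T) (le_max_right _ _)
  have hTe : T * X.eps ^ 2 ≤ T := by
    have : X.eps ^ 2 ≤ 1 := by nlinarith
    nlinarith
  have hstl : Real.log T / Real.log X.G ≤ cg := by
    rw [div_le_iff₀ (by linarith)]; exact hlL
  exact
  { T_ge := hT
    one_le_logT := hl
    G_ge := hG2
    one_le_logG := hL
    logT_le := hlL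
    s0_pos := hs0
    s0_le_T := by nlinarith
    s0_le_G := hsG
    groupNorm_pos := hK
    size_mul_le := hsm
    size_le := fun j => by
      have h1 := hsm j
      have h2 : (X.g j : ℝ) ≤ Real.log X.G := by
        have h3 : cg * Real.log X.G ≤ Real.log T * Real.log X.G := by gcongr
        refine le_of_mul_le_mul_right (a := Real.log T) ?_ (by linarith)
        linarith
      have h3 : Real.log X.G ≤ X.s0 * Real.log X.G := by nlinarith
      exact_mod_cast h2.trans (h3.trans (hle.trans hTe))
    le_lam := fun j => by
      refine le_trans ?_ (hpen.2 j).1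
      gcongr
      nlinarith
    lam_le := fun j => (hpen.2 j).2.trans (mul_le_mul_of_nonneg_left (min_le_left _ _) hChi.le)
    lam_le' := fun j => (hpen.2 j).2.trans (mul_le_mul_of_nonneg_left (min_le_right _ _) hChi.le)
    beta_cond := hbeta.1
    le_d := hbeta.2.1
    log_add_le := hbeta.2.2.2
    eps_pos := heps0
    eps_le := heps
    le_eps := hle
    logT_le_eps := hle2
    s0_le_sTilde := le_max_left _ _
    sTilde_le := max_le (by nlinarith) (by nlinarith) }

theorem theorem2
    (vlo vhi cg cθ clo Chi u dlo cπ a1 b1 : ℝ)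
    (hvlo : 0 < vlo) (hvhi : vlo ≤ vhi) (hcg : 0 < cg) (hcθ : 0 < cθ)
    (hclo : 1 < clo) (hChi : clo < Chi) (hu : 0 < u) (hdlo : 0 < dlo) (hcπ : 0 < cπ)
    (ha1 : 1 < a1) (hb1 : 0 < b1) :
    ∃ M₂₀ : ℝ, 0 < M₂₀ ∧ ∀ M₂ : ℝ, M₂₀ ≤ M₂ →
    ∃ M₀ : ℝ, 0 < M₀ ∧ ∀ M : ℝ, M₀ ≤ M →
    ∀ X : (T : ℕ) → Setup T,
      (∀ᶠ T in atTop, (X T).GroupSizeCond cg) →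
      (∀ᶠ T in atTop, (X T).PenaltyCond clo Chi) →
      (∀ᶠ T in atTop, (X T).BetaCond u dlo cπ) →
      Tendsto (fun T => (X T).eps) atTop (𝓝 0) →
      Tendsto
        (fun T => ⨆ θ₀ ∈ (X T).trueCoef cθ, ⨆ v₀ ∈ Set.Icc vlo vhi,
          ∫⁻ y, (X T).posterior a1 b1 y
              {θ | (X T).radius M M₂ ≤ ENNReal.ofReal (normSq (θ - θ₀))}
            ∂(dataLaw (X T).Z θ₀ v₀))
        atTop (𝓝 0) := by
  have hChi0 : 0 < Chi := by linarith
  have ha : 0 < a1 := by linarith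
  have hvhi0 : 0 < vhi := hvlo.trans_le hvhi
  obtain ⟨C, hC, hev⟩ := exists_evidence_const (cπ := cπ) hvlo hvhi hcg hcθ hChi0 hu hdlo ha hb1
  refine ⟨(C + 3) / u, by positivity, fun M₂ hM₂ => ?_⟩
  have hM₂0 : 0 < M₂ := lt_of_lt_of_le (by positivity) hM₂
  have huM₂ : C + 3 ≤ u * M₂ := by
    rw [div_le_iff₀ hu] at hM₂; linarith
  have hA : 0 < 16 * vhi * (4 * (3 + (1 + M₂ * (1 + cg)) * (1 + cg))) := by positivity
  have hB : 0 < 8 * vhi * (C + 2) := by positivity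
  -- The sum of two thresholds: the first lets the signal dominate the noise cross term, the second
  -- lets the likelihood drop beat the evidence constant `C`.
  refine ⟨16 * vhi * (4 * (3 + (1 + M₂ * (1 + cg)) * (1 + cg))) + 8 * vhi * (C + 2),
    by positivity, fun M hM X hsize hpen hbeta heps => ?_⟩
  have hM0 : 0 < M := by linarith
  have hM2 : C + 1 ≤ M / (8 * vhi) - 1 := by
    rw [le_sub_iff_add_le, le_div_iff₀ (by positivity)]; linarith
  have hlog : Tendsto (fun T : ℕ => Real.log T) atTop atTop :=
    Real.tendsto_log_atTop.comp tendsto_natCast_atTop_atTop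
  have hbound : Tendsto (fun T : ℕ =>
      ENNReal.ofReal (Var[fun x : ℝ => x ^ 2; gaussianReal 0 1] / Real.log T) +
        3 * ENNReal.ofReal (Real.exp (-(Real.log T / cg)))) atTop (𝓝 0) := by
    have h1 : Tendsto (fun T : ℕ => ENNReal.ofReal
        (Var[fun x : ℝ => x ^ 2; gaussianReal 0 1] / Real.log T)) atTop (𝓝 0) := by
      have := ENNReal.tendsto_ofReal (hlog.const_div_atTop
        (Var[fun x : ℝ => x ^ 2; gaussianReal 0 1]))
      simpa using this
    have h2 : Tendsto (fun T : ℕ => ENNReal.ofReal (Real.exp (-(Real.log T / cg)))) atTop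
        (𝓝 0) := by
      have := ENNReal.tendsto_ofReal (Real.tendsto_exp_neg_atTop_nhds_zero.comp
        (hlog.atTop_div_const hcg))
      simpa [Function.comp_def] using this
    have h3 := ENNReal.Tendsto.const_mul (a := 3) h2 (Or.inr (by norm_num))
    simpa using h1.add h3
  have hepsM : ∀ᶠ T in atTop, M * (X T).eps ^ 2 / (2 * vhi) ≤ 1 / 4 := by
    have h1 : Tendsto (fun T => M * (X T).eps ^ 2 / (2 * vhi)) atTop (𝓝 0) := by
      simpa using ((heps.pow 2).const_mul M).div_const (2 * vhi)
    exact h1.eventually_le_const (by norm_num)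
  refine tendsto_of_tendsto_of_tendsto_of_le_of_le' tendsto_const_nhds hbound
    (Eventually.of_forall fun _ => zero_le) ?_
  filter_upwards [hsize, hpen, hbeta, hepsM, heps.eventually_le_const (by norm_num : (0 : ℝ) < 1 / 4),
    eventually_ge_atTop 3, hlog.eventually_ge_atTop 1, hlog.eventually_ge_atTop cg]
    with T h1 h2 h3 h4 h5 h6 h7 h8
  -- A true vector is fixed before the working assumptions are derived, since `s₀ ≤ G` comes from
  -- its existence; if there is none, the supremum is 0.
  refine iSup₂_le fun θ₀ hθ₀ => iSup₂_le fun v₀ hv₀ => ?_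
  have hX : Regime (X T) cg Chi u dlo cπ :=
    Regime.of_conditions hcg hclo hChi0 hdlo h6 h7 h8 h1 h2 h3 h5 hθ₀
  refine (lintegral_posterior_le hX hvlo hcg hu ha hb1 hC hM₂0 huM₂ hM0 (by linarith) hM2 h4
    hθ₀ hv₀ (hev T (X T) hX θ₀ hθ₀ v₀ hv₀)).trans ?_
  gcongr
  rw [div_le_iff₀ hcg]
  linarith [hX.logT_le]
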